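/- Let $n\ge 1$ be an integer, $\mu_1,\mu_2\in\mathbb R$, $\delta:=(\mu_1-1)^2-4\mu_2\ge 0$, and consider $$u_{tt}-\Delta u+\frac{\mu_1}{1+t}u_t+\frac{\mu_2}{(1+t)^2}u=|u|^p\ \text{ in }\mathbb R^n\times(0,T),\qquad u(x,0)=\varepsilon f(x),\quad u_t(x,0)=\varepsilon g(x). \tag{1}$$ Put $\gamma_F(p,\nu)=2-\nu(p-1)$ and $\gamma_S(p,\nu)=2+(\nu+1)p-(\nu-1)p^2$; $p_F(\nu)=1+\frac2\nu$ if $\nu>0$ and $+\infty$ if $\nu\le0$; $p_S(\nu)=\frac{\nu+1+\sqrt{\nu^2+10\nu-7}}{2(\nu-1)}$ if $\nu>1$ and $+\infty$ if $\nu\le1$; $d_*(\nu)=\frac12\bigl(-1-\nu+\sqrt{\nu^2+10\nu-7}\bigr)$ if $\nu>1$ and $0$ if $\nu\le1$; and $\operatorname{sgn}\delta=1$ if $\delta>0$, $\operatorname{sgn}0=0$. Let $$1<p<p_{\mu_1,\delta}(n):=\max\Bigl\{p_F\bigl(n+\tfrac{\mu_1-1-\sqrt\delta}{2}\bigr),\,p_S(n+\mu_1)\Bigr\}.$$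 Let $f\in H^1(\mathbb R^n)$, $g\in L^2(\mathbb R^n)$ be such that, almost everywhere, $f\ge0$ and $h:=\frac{\mu_1-1+\sqrt\delta}{2}f+g\ge0$, with $h$ not almost everywhere zero. Let $R\ge1$. An energy solution of (1) on $[0,T)$ is a function $u\in C([0,T),H^1(\mathbb R^n))\cap C^1([0,T),L^2(\mathbb R^n))\cap C((0,T),L^p_{loc}(\mathbb R^n))$ with $u(0)=\varepsilon f$, $u_t(0)=\varepsilon g$ such that for all $\phi\in C_0^\infty(\mathbb R^n\times[0,T))$ and $t\in[0,T)$ the function $s\mapsto\int_{\mathbb R^n}|u(x,s)|^p\phi(x,s)\,dx$ is integrable on $(0,t)$ and $$\begin{aligned}&\int_{\mathbb R^n}u_t(x,t)\phi(x,t)\,dx-\int_{\mathbb R^n}\varepsilon g(x)\phi(x,0)\,dx+\int_0^t\!\!\int_{\mathbb R^n}\{-u_t\phi_t+\nabla u\cdot\nabla\phi\}\,dx\,ds\\&+\int_0^t\!\!\int_{\mathbb R^n}\frac{\mu_1}{1+s}u_t\phi\,dx\,ds+\int_0^t\!\!\int_{\mathbb R^n}\frac{\mu_2}{(1+s)^2}u\phi\,dx\,ds=\int_0^t\!\!\int_{\mathbb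 R^n}|u|^p\phi\,dx\,ds.\end{aligned}$$ Let the lifespan $T_\varepsilon\in[0,\infty]$ be the supremum of all $T>0$ for which there is an energy solution $u$ of (1) on $[0,T)$ with $\operatorname{supp}u\subset\{(x,t):|x|\le t+R\}$. Then there are constants $\varepsilon_2>0$ and $C>0$, depending only on $f,g,\mu_1,\mu_2,n,p,R$, such that for all $0<\varepsilon\le\varepsilon_2$: * if $\sqrt\delta\le n-2$, then $T_\varepsilon\le C\,\varepsilon^{-2p(p-1)/\gamma_S(p,n+\mu_1)}$; * if $n-2<\sqrt\delta<n-d_*(n+\mu_1)$, then $T_\varepsilon\le C\,\phi(\varepsilon)$ when $1<p\le\frac{2}{n-\sqrt\delta}$, and $T_\varepsilon\le C\,\varepsilon^{-2p(p-1)/\gamma_S(p,n+\mu_1)}$ when $\frac2{n-\sqrt\delta}<p<p_{\mu_1,\delta}(n)$; * if $\sqrt\delta\ge n-d_*(n+\mu_1)$, then $T_\varepsilon\le C\,\phi(\varepsilon)$. Here, in each case in which it occurs, $\phi=\phi(\varepsilon)$ is, for every $\varepsilon>0$, the unique positive solution of $$\varepsilon\,\phi^{\frac{\gamma_F(p,\,n+(\mu_1-1-\sqrt\delta)/2)}{p-1}}\,\bigl[\ln(1+\phi)\bigr]^{1-\operatorname{sgn}\delta}=1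 .$$ If in particular $\delta>0$, then in these cases $$\phi(\varepsilon)=\varepsilon^{-(p-1)/\gamma_F(p,\,n+(\mu_1-1-\sqrt\delta)/2)}=\varepsilon^{-\left[2/(p-1)-n-(\mu_1-1-\sqrt\delta)/2\right]^{-1}}.$$ -/

import Mathlib

open MeasureTheory Set Filter Topology
open scoped ENNReal ContDiff

noncomputable section

namespace ScaleInvariantWave

/-- The Euclidean space `ℝⁿ`. -/
abbrev Space (n : ℕ) : Type := EuclideanSpace ℝ (Fin n)

/-! ### Exponents -/

/-- The Fujita exponent `p_F(ν)`, equal to `+∞` for `ν ≤ 0`. -/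
def fujitaExponent (ν : ℝ) : EReal :=
  if 0 < ν then ((1 + 2 / ν : ℝ) : EReal) else ⊤

/-- The Strauss exponent `p_S(ν)`, equal to `+∞` for `ν ≤ 1`. -/
def straussExponent (ν : ℝ) : EReal :=
  if 1 < ν then
    (((ν + 1 + Real.sqrt (ν ^ 2 + 10 * ν - 7)) / (2 * (ν - 1)) : ℝ) : EReal)
  else ⊤

/-- `γ_F(p, ν) = 2 - ν (p - 1)`. -/
def gammaF (p ν : ℝ) : ℝ := 2 - ν * (p - 1)

/-- `γ_S(p, ν) = 2 + (ν + 1) p - (ν - 1) p²`. -/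
def gammaS (p ν : ℝ) : ℝ := 2 + (ν + 1) * p - (ν - 1) * p ^ 2

/-- The threshold `d_*(ν)`. -/
def dStar (ν : ℝ) : ℝ :=
  if 1 < ν then (-1 - ν + Real.sqrt (ν ^ 2 + 10 * ν - 7)) / 2 else 0

/-- `δ = (μ₁ - 1)² - 4 μ₂`. -/
def discr (μ₁ μ₂ : ℝ) : ℝ := (μ₁ - 1) ^ 2 - 4 * μ₂

/-- The shifted dimension `n + (μ₁ - 1 - √δ) / 2`. -/
def heatDim (n : ℕ) (μ₁ δ : ℝ) : ℝ := n + (μ₁ - 1 - Real.sqrt δ) / 2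

/-- `p_{μ₁,δ}(n) = max {p_F(n + (μ₁ - 1 - √δ)/2), p_S(n + μ₁)}`. -/
def blowupExponent (n : ℕ) (μ₁ δ : ℝ) : EReal :=
  max (fujitaExponent (heatDim n μ₁ δ)) (straussExponent (n + μ₁))

/-- `y` is a (positive) solution of
`ε y ^ (γ_F(p, n + (μ₁ - 1 - √δ)/2) / (p - 1)) (ln (1 + y)) ^ (1 - sgn δ) = 1`. -/
def IsHeatScale (n : ℕ) (μ₁ δ p ε y : ℝ) : Prop :=
  0 < y ∧
    ε * y ^ (gammaF p (heatDim n μ₁ δ) / (p - 1)) * Real.log (1 + y) ^ (1 - Real.sign δ) = 1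

/-! ### Function spaces -/

/-- `G` is the weak gradient of `w` on `ℝⁿ` (tested in every direction `e`). -/
def IsWeakGradient {n : ℕ} (w : Space n → ℝ) (G : Space n → Space n) : Prop :=
  ∀ ψ : Space n → ℝ, ContDiff ℝ ∞ ψ → HasCompactSupport ψ → ∀ e : Space n,
    ∫ x, w x * fderiv ℝ ψ x e = - ∫ x, inner ℝ (G x) e * ψ x

/-- `w ∈ H¹(ℝⁿ)`. -/
def MemH1 {n : ℕ} (w : Space n → ℝ) : Prop :=
  MemLp w 2 ∧ ∃ G : Space n → Space n, MemLp G 2 ∧ IsWeakGradient w G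

/-- `φ ∈ C_0^∞(ℝⁿ × [0, T))`: the restriction to nonnegative times of a smooth function on
`ℝⁿ × ℝ` whose support is compact and lies in `{t < T}`. -/
def IsTestFunction {n : ℕ} (T : ℝ) (φ : Space n × ℝ → ℝ) : Prop :=
  ContDiff ℝ ∞ φ ∧ HasCompactSupport φ ∧ ∀ z ∈ tsupport φ, z.2 < T

/-- `u ∈ C((0, T), L^p_loc(ℝⁿ))`. -/
def ContinuousLpLoc {n : ℕ} (p T : ℝ) (u : ℝ → Space n → ℝ) : Prop :=
  ∀ K : Set (Space n), IsCompact K → ∀ t ∈ Ioo 0 T,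
    MemLp (u t) (ENNReal.ofReal p) (volume.restrict K) ∧
      Tendsto (fun s => eLpNorm (u s - u t) (ENNReal.ofReal p) (volume.restrict K)) (𝓝 t) (𝓝 0)

/-! ### Energy solutions and lifespan -/

/-- `u` is an energy solution over `[0, T)` of
`u_tt - Δu + μ₁/(1+t) u_t + μ₂/(1+t)² u = |u|^p`, `u(0) = ε f`, `u_t(0) = ε g`.

The curves `v` and `G` are `u_t` and `∇u`: continuity of `u` and `G` in `L²` says that
`u ∈ C([0, T), H¹)`, and the conditions on `v` say that `u ∈ C¹([0, T), L²)`.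
The weak equation presupposes that its right-hand side exists; the only point at which this does
not follow from the regularity of `u` is the integrability in time near `0`, which is required
explicitly. -/
def IsEnergySolution (n : ℕ) (μ₁ μ₂ p ε : ℝ) (f g : Space n → ℝ) (T : ℝ)
    (u : ℝ → Lp ℝ 2 (volume : Measure (Space n))) : Prop :=
  ∃ (v : ℝ → Lp ℝ 2 (volume : Measure (Space n)))
    (G : ℝ → Lp (Space n) 2 (volume : Measure (Space n))),
    ContinuousOn u (Ico 0 T) ∧
    ContinuousOn G (Ico 0 T) ∧
    (∀ t ∈ Ico 0 T, IsWeakGradient (u t) (G t)) ∧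
    (∀ t ∈ Ico 0 T, HasDerivWithinAt u (v t) (Ico 0 T) t) ∧
    ContinuousOn v (Ico 0 T) ∧
    ContinuousLpLoc p T (fun t => u t) ∧
    (u 0 =ᵐ[volume] fun x => ε * f x) ∧
    (v 0 =ᵐ[volume] fun x => ε * g x) ∧
    ∀ φ : Space n × ℝ → ℝ, IsTestFunction T φ → ∀ t ∈ Ico 0 T,
      IntervalIntegrable (fun s => ∫ x, |u s x| ^ p * φ (x, s)) volume 0 t ∧
      (∫ x, v t x * φ (x, t)) - (∫ x, ε * g x * φ (x, 0))
        + (∫ s in (0 : ℝ)..t, ∫ x, (- (v s x * deriv (fun r => φ (x, r)) s)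
            + inner ℝ (G s x) (gradient (fun y => φ (y, s)) x)))
        + (∫ s in (0 : ℝ)..t, ∫ x, μ₁ / (1 + s) * v s x * φ (x, s))
        + (∫ s in (0 : ℝ)..t, ∫ x, μ₂ / (1 + s) ^ 2 * u s x * φ (x, s))
      = ∫ s in (0 : ℝ)..t, ∫ x, |u s x| ^ p * φ (x, s)

/-- `supp u ⊆ {(x, t) : |x| ≤ t + R}` for a curve `u` over `[0, T)`. -/
def SupportedInCone {n : ℕ} (R T : ℝ) (u : ℝ → Lp ℝ 2 (volume : Measure (Space n))) : Prop :=
  ∀ t ∈ Ico 0 T, ∀ᵐ x, t + R < ‖x‖ → u t x = 0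

/-- The lifespan `T_ε`: the supremum of all `T > 0` for which there is an energy solution over
`[0, T)` with data `ε f`, `ε g` and support in `{|x| ≤ t + R}`. -/
def lifespan (n : ℕ) (μ₁ μ₂ p R : ℝ) (f g : Space n → ℝ) (ε : ℝ) : ℝ≥0∞ :=
  sSup {τ : ℝ≥0∞ | ∃ T : ℝ, 0 < T ∧ τ = ENNReal.ofReal T ∧
    ∃ u : ℝ → Lp ℝ 2 (volume : Measure (Space n)),
      IsEnergySolution n μ₁ μ₂ p ε f g T u ∧ SupportedInCone R T u}

end ScaleInvariantWave

end

open ScaleInvariantWave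

/-!
Testing the equation with a cutoff that is `1` on the light cone, or with the plane waves
`exp (x · ξ)`, turns it into `A'' + μ₁ / (1 + t) A' + μ₂ / (1 + t)² A = |ξ|² A + N` for the
corresponding moments `A` of `u` and `N` of `|u| ^ p`. With `κ ≤ a` the roots of
`λ² - (μ₁ - 1) λ + μ₂`, so that `a - κ = √δ`, and `t = exp τ - 1`, the equation for `ξ = 0` becomes
`F' = D - √δ F`, `D' = P` for `F = exp (κ τ) A`.

Hölder's inequality on the ball of radius `t + R` bounds the forcing below by
`P ≥ c exp (γ_F τ) F ^ p`, which is superlinear, so that `F` blows up within one unit of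
logarithmic time once `F` and `D` reach the size `exp (-γ_F τ / (p - 1))`. There are two sources of
growth. The data give `D ≥ ε H`, and hence `F ≥ c ε τ` if `δ = 0` and `F ≥ c ε` otherwise: this is
the heat-like bound. The moments against `exp (x · ξ)` with `|ξ| = 1` grow like
`ε exp t (1 + t) ^ (-μ₁ / 2)`; averaging over `ξ` and applying Hölder's inequality bounds
`∫ |u| ^ p` and hence `P` below: this is the wave-like bound.
-/

namespace ScaleInvariantWave

/-! ### Ordinary differential inequalities -/

theorem add_mul_le_of_le_hasDerivAt {f f' : ℝ → ℝ} {a b m : ℝ} (hab : a ≤ b)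
    (hf : ContinuousOn f (Icc a b)) (hf' : ∀ x ∈ Ioo a b, HasDerivAt f (f' x) x)
    (hm : ∀ x ∈ Ioo a b, m ≤ f' x) : f a + m * (b - a) ≤ f b := by
  have := (convex_Icc a b).mul_sub_le_image_sub_of_le_deriv hf
    (fun x hx => (hf' x (by simpa using hx)).differentiableAt.differentiableWithinAt)
    (fun x hx => by
      have hx' : x ∈ Ioo a b := by simpa using hx
      exact (hm x hx').trans_eq (hf' x hx').deriv.symm)
    a (left_mem_Icc.2 hab) b (right_mem_Icc.2 hab) hab
  linarith

theorem le_of_hasDerivAt_nonneg {f f' : ℝ → ℝ} {a b : ℝ} (hab : a ≤ b)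
    (hf : ContinuousOn f (Icc a b)) (hf' : ∀ x ∈ Ioo a b, HasDerivAt f (f' x) x)
    (hf'0 : ∀ x ∈ Ioo a b, 0 ≤ f' x) : f a ≤ f b := by
  simpa using add_mul_le_of_le_hasDerivAt hab hf hf' hf'0

theorem pos_of_forall_lt_pos {y : ℝ → ℝ} {a b : ℝ} (hy : ContinuousOn y (Icc a b)) (ha : 0 < y a)
    (step : ∀ s ∈ Ioc a b, (∀ r ∈ Ico a s, 0 < y r) → 0 < y s) :
    ∀ s ∈ Icc a b, 0 < y s := by
  by_contra! hne
  obtain ⟨s, hs, hys⟩ := hne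
  have hcompact : IsCompact (Icc a b ∩ y ⁻¹' Iic 0) :=
    isCompact_Icc.of_isClosed_subset (hy.preimage_isClosed_of_isClosed isClosed_Icc isClosed_Iic)
      inter_subset_left
  obtain ⟨t, ⟨ht, hyt⟩, hleast⟩ := hcompact.exists_isLeast ⟨s, hs, hys⟩
  have hat : a < t := ht.1.lt_of_ne fun h => absurd (h ▸ hyt : y a ≤ 0) (not_le.2 ha)
  refine absurd (step t ⟨hat, ht.2⟩ fun r hr => ?_) (not_lt.2 hyt)
  by_contra hr0
  exact absurd (hleast ⟨⟨hr.1, hr.2.le.trans ht.2⟩, not_lt.1 hr0⟩) (not_le.2 hr.2)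

theorem le_and_le_of_cooperative {x x' y y' : ℝ → ℝ} {a b : ℝ} (hab : a ≤ b)
    (hx : ContinuousOn x (Icc a b)) (hy : ContinuousOn y (Icc a b))
    (hx' : ∀ t ∈ Ioo a b, HasDerivAt x (x' t) t) (hy' : ∀ t ∈ Ioo a b, HasDerivAt y (y' t) t)
    (hxy : ∀ t ∈ Ioo a b, 0 < y t → 0 ≤ x' t) (hyx : ∀ t ∈ Ioo a b, x a ≤ x t → 0 ≤ y' t)
    (hya : 0 < y a) : x a ≤ x b ∧ y a ≤ y b := by
  have x_le (s : ℝ) (hs : s ∈ Icc a b) (hpos : ∀ r ∈ Ico a s, 0 < y r) : x a ≤ x s := by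
    have hsub : Ioo a s ⊆ Ioo a b := Ioo_subset_Ioo_right hs.2
    exact le_of_hasDerivAt_nonneg hs.1 (hx.mono (Icc_subset_Icc_right hs.2))
      (fun r hr => hx' r (hsub hr)) fun r hr => hxy r (hsub hr) (hpos r (Ioo_subset_Ico_self hr))
  have y_le (s : ℝ) (hs : s ∈ Icc a b) (hpos : ∀ r ∈ Ico a s, 0 < y r) : y a ≤ y s := by
    have hsub : Ioo a s ⊆ Ioo a b := Ioo_subset_Ioo_right hs.2
    refine le_of_hasDerivAt_nonneg hs.1 (hy.mono (Icc_subset_Icc_right hs.2))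
      (fun r hr => hy' r (hsub hr)) fun r hr => hyx r (hsub hr) ?_
    exact x_le r (Ioo_subset_Icc_self (hsub hr)) fun q hq => hpos q ⟨hq.1, hq.2.trans hr.2⟩
  have y_pos := pos_of_forall_lt_pos hy hya fun s hs hpos =>
    hya.trans_le (y_le s (Ioc_subset_Icc_self hs) hpos)
  have hb := right_mem_Icc.2 hab
  exact ⟨x_le b hb fun r hr => y_pos r (Ico_subset_Icc_self hr),
    y_le b hb fun r hr => y_pos r (Ico_subset_Icc_self hr)⟩

theorem hasDerivAt_exp_mul (b t : ℝ) :
    HasDerivAt (fun t => Real.exp (b * t)) (Real.exp (b * t) * b) t := by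
  simpa using ((hasDerivAt_id t).const_mul b).exp

/-! ### Blow-up of a superlinear system -/

/-- The profile `Y (σ - τ) ^ (-q)`, which blows up as `τ` increases to `σ`; for `q = 2 / (p - 1)`
it has the blow-up rate of `F'' = F ^ p`. -/
noncomputable def blowupProfile (Y q σ τ : ℝ) : ℝ := Y * (σ - τ) ^ (-q)

section blowupProfile

variable {p b c Y q σ τ : ℝ}

theorem hasDerivAt_blowupProfile (Y q : ℝ) (hτ : τ < σ) :
    HasDerivAt (blowupProfile Y q σ) (q * blowupProfile Y (q + 1) σ τ) τ := by
  have h := ((hasDerivAt_id τ).const_sub σ).rpow_const (p := -q) (Or.inl (sub_pos.2 hτ).ne')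
  refine (h.const_mul Y).congr_deriv ?_
  simp only [blowupProfile, neg_add', id]
  ring

theorem blowupProfile_nonneg (hY : 0 ≤ Y) (hτ : τ < σ) : 0 ≤ blowupProfile Y q σ τ :=
  mul_nonneg hY (Real.rpow_nonneg (sub_pos.2 hτ).le _)

theorem blowupProfile_sub_one (Y q σ : ℝ) : blowupProfile Y q σ (σ - 1) = Y := by
  simp [blowupProfile]

theorem tendsto_blowupProfile_atTop (hY : 0 < Y) (hq : 0 < q) (σ : ℝ) :
    Tendsto (blowupProfile Y q σ) (𝓝[<] σ) atTop := by
  refine Tendsto.const_mul_atTop hY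
    ((tendsto_rpow_neg_nhdsGT_zero (neg_lt_zero.2 hq)).comp (tendsto_nhdsWithin_iff.2 ⟨?_, ?_⟩))
  · exact ((continuous_sub_left σ).tendsto' σ 0 (sub_self σ)).mono_left nhdsWithin_le_nhds
  · filter_upwards [self_mem_nhdsWithin] with τ hτ using sub_pos.2 (mem_Iio.1 hτ)

theorem blowupProfile_rpow (hp : 1 < p) (hY : 0 ≤ Y) (hτ : τ < σ) :
    blowupProfile Y (2 / (p - 1)) σ τ ^ p
      = Y ^ (p - 1) * blowupProfile Y (2 / (p - 1) + 2) σ τ := by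
  have hexp : -(2 / (p - 1)) * p = -(2 / (p - 1) + 2) := by
    field_simp [(sub_pos.2 hp).ne']
    ring
  have hYp : Y ^ p = Y ^ (p - 1) * Y := by
    rw [← Real.rpow_add_one' hY (by linarith), sub_add_cancel]
  have hθ : 0 ≤ σ - τ := (sub_pos.2 hτ).le
  rw [blowupProfile, blowupProfile, Real.mul_rpow hY (Real.rpow_nonneg hθ _),
    ← Real.rpow_mul hθ, hexp, hYp, mul_assoc]

theorem blowupProfile_subsolution (hp : 1 < p) (hb : 0 ≤ b) (hY : 0 ≤ Y)
    (hcY : 2 / (p - 1) * (2 / (p - 1) + 1) + b * (2 / (p - 1)) ≤ c * Y ^ (p - 1))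
    (hτ : τ ∈ Ico (σ - 1) σ) :
    2 / (p - 1) * ((2 / (p - 1) + 1) * blowupProfile Y (2 / (p - 1) + 2) σ τ)
        + b * (2 / (p - 1) * blowupProfile Y (2 / (p - 1) + 1) σ τ)
      ≤ c * blowupProfile Y (2 / (p - 1)) σ τ ^ p := by
  rw [blowupProfile_rpow hp hY hτ.2]
  have hq : 0 < 2 / (p - 1) := div_pos two_pos (sub_pos.2 hp)
  set q := 2 / (p - 1)
  have hle : blowupProfile Y (q + 1) σ τ ≤ blowupProfile Y (q + 2) σ τ :=
    mul_le_mul_of_nonneg_left (Real.rpow_le_rpow_of_exponent_ge (sub_pos.2 hτ.2)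
      (by linarith [hτ.1]) (by linarith)) hY
  have hnonneg := blowupProfile_nonneg (q := q + 2) hY hτ.2
  calc q * ((q + 1) * blowupProfile Y (q + 2) σ τ) + b * (q * blowupProfile Y (q + 1) σ τ)
      ≤ q * ((q + 1) * blowupProfile Y (q + 2) σ τ) + b * (q * blowupProfile Y (q + 2) σ τ) := by
        gcongr
    _ = (q * (q + 1) + b * q) * blowupProfile Y (q + 2) σ τ := by ring
    _ ≤ c * Y ^ (p - 1) * blowupProfile Y (q + 2) σ τ := by gcongr
    _ = c * (Y ^ (p - 1) * blowupProfile Y (q + 2) σ τ) := mul_assoc _ _ _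

variable {F D D' : ℝ → ℝ}

theorem blowupProfile_le (hp : 1 < p) (hb : 0 ≤ b) (hc : 0 ≤ c) (hY : 0 ≤ Y)
    (hcY : 2 / (p - 1) * (2 / (p - 1) + 1) + b * (2 / (p - 1)) ≤ c * Y ^ (p - 1))
    (hF : ∀ τ ∈ Icc (σ - 1) σ, HasDerivAt F (D τ - b * F τ) τ)
    (hD : ∀ τ ∈ Icc (σ - 1) σ, HasDerivAt D (D' τ) τ)
    (hD' : ∀ τ ∈ Icc (σ - 1) σ, c * |F τ| ^ p ≤ D' τ)
    (hF0 : Y ≤ F (σ - 1)) (hD0 : Y * (2 / (p - 1) + b) < D (σ - 1))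
    (hτ : τ ∈ Ico (σ - 1) σ) : blowupProfile Y (2 / (p - 1)) σ τ ≤ F τ := by
  set q := 2 / (p - 1)
  set Fs := blowupProfile Y q σ with hFs
  set Ds := fun r => q * blowupProfile Y (q + 1) σ r + b * Fs r with hDs
  have hFd (r : ℝ) (hr : r ∈ Icc (σ - 1) τ) :
      HasDerivAt (fun r => Real.exp (b * r) * (F r - Fs r))
        (Real.exp (b * r) * (D r - Ds r)) r := by
    refine ((hasDerivAt_exp_mul b r).mul ((hF r ⟨hr.1, hr.2.trans hτ.2.le⟩).sub
      (hasDerivAt_blowupProfile Y q (hr.2.trans_lt hτ.2)))).congr_deriv ?_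
    simp only [Pi.sub_apply, hDs, hFs]
    ring
  have hDd (r : ℝ) (hr : r ∈ Icc (σ - 1) τ) :
      HasDerivAt (fun r => D r - Ds r) (D' r - (q * ((q + 1) * blowupProfile Y (q + 2) σ r)
        + b * (q * blowupProfile Y (q + 1) σ r))) r := by
    have hrσ := hr.2.trans_lt hτ.2
    refine (hD r ⟨hr.1, hrσ.le⟩).sub
      (((hasDerivAt_blowupProfile Y (q + 1) hrσ).const_mul q).add
        ((hasDerivAt_blowupProfile Y q hrσ).const_mul b) |>.congr_deriv ?_)
    norm_num [add_assoc]
  have hstart : Fs (σ - 1) = Y := blowupProfile_sub_one Y q σ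
  have hFstart : 0 ≤ Real.exp (b * (σ - 1)) * (F (σ - 1) - Fs (σ - 1)) :=
    mul_nonneg (Real.exp_pos _).le (by linarith)
  have hDstart : 0 < D (σ - 1) - Ds (σ - 1) := by
    simp only [hDs, blowupProfile_sub_one, hstart]
    linarith
  have hcomparison := (le_and_le_of_cooperative hτ.1
    (fun r hr => (hFd r hr).continuousAt.continuousWithinAt)
    (fun r hr => (hDd r hr).continuousAt.continuousWithinAt)
    (fun r hr => hFd r (Ioo_subset_Icc_self hr)) (fun r hr => hDd r (Ioo_subset_Icc_self hr))
    (fun r _ hpos => mul_nonneg (Real.exp_pos _).le hpos.le) (fun r hr hle => ?_) hDstart).1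
  · exact sub_nonneg.1 (nonneg_of_mul_nonneg_right (hFstart.trans hcomparison) (Real.exp_pos _))
  · have hrσ : r ∈ Ico (σ - 1) σ := ⟨hr.1.le, hr.2.trans hτ.2⟩
    have hFr : Fs r ≤ F r :=
      sub_nonneg.1 (nonneg_of_mul_nonneg_right (hFstart.trans hle) (Real.exp_pos _))
    have hFs0 : 0 ≤ Fs r := blowupProfile_nonneg hY hrσ.2
    refine sub_nonneg.2 ((blowupProfile_subsolution hp hb hY hcY hrσ).trans
      (le_trans ?_ (hD' r (Ico_subset_Icc_self hrσ))))
    gcongr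
    exact hFr.trans (le_abs_self _)

theorem not_hasDerivAt_of_large (hp : 1 < p) (hb : 0 ≤ b) (hc : 0 ≤ c) (hY : 0 < Y)
    (hcY : 2 / (p - 1) * (2 / (p - 1) + 1) + b * (2 / (p - 1)) ≤ c * Y ^ (p - 1))
    (hF : ∀ τ ∈ Icc (σ - 1) σ, HasDerivAt F (D τ - b * F τ) τ)
    (hD' : ∀ τ ∈ Icc (σ - 1) σ, c * |F τ| ^ p ≤ D' τ)
    (hF0 : Y ≤ F (σ - 1)) (hD0 : Y * (2 / (p - 1) + b) < D (σ - 1)) :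
    ¬ ∀ τ ∈ Icc (σ - 1) σ, HasDerivAt D (D' τ) τ := by
  intro hD
  obtain ⟨M, hM⟩ := isCompact_Icc.exists_bound_of_continuousOn
    (fun τ hτ => (hF τ hτ).continuousAt.continuousWithinAt : ContinuousOn F (Icc (σ - 1) σ))
  have hlarge := (tendsto_blowupProfile_atTop hY (div_pos two_pos (sub_pos.2 hp)) σ).eventually
    (eventually_gt_atTop M)
  have hnear : ∀ᶠ τ in 𝓝[<] σ, τ ∈ Ico (σ - 1) σ := Ico_mem_nhdsLT (sub_one_lt σ)
  obtain ⟨τ, hMτ, hτ⟩ := (hlarge.and hnear).exists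
  have hle := blowupProfile_le hp hb hc hY.le hcY hF hD hD' hF0 hD0 hτ
  linarith [(le_abs_self _).trans (hM τ (Ico_subset_Icc_self hτ))]

end blowupProfile

/-! ### The equation satisfied by moments -/

/-- The equation `A'' + μ₁ / (1 + t) A' + μ₂ / (1 + t) ^ 2 A = k A + N` over `[0, T)` with source
`N ≥ 0`, written as a first-order system with `B = A'`. -/
structure MomentSystem (μ₁ μ₂ k T : ℝ) (A B N : ℝ → ℝ) : Prop where
  continuousOn_left : ContinuousOn A (Ico 0 T)
  continuousOn_right : ContinuousOn B (Ico 0 T)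
  hasDerivAt_left : ∀ t ∈ Ioo 0 T, HasDerivAt A (B t) t
  hasDerivAt_right : ∀ t ∈ Ioo 0 T,
    HasDerivAt B (k * A t - μ₁ / (1 + t) * B t - μ₂ / (1 + t) ^ 2 * A t + N t) t
  nonneg : ∀ t ∈ Ioo 0 T, 0 ≤ N t

/-- The flux `(1 + t) ^ κ ((1 + t) A' + a A)`. When `a + κ = μ₁ - 1` and `a κ = μ₂` it factors the
operator `∂ₜ² + μ₁ / (1 + t) ∂ₜ + μ₂ / (1 + t) ^ 2`. -/
noncomputable def weightedFlux (a κ : ℝ) (A B : ℝ → ℝ) (t : ℝ) : ℝ :=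
  (1 + t) ^ κ * ((1 + t) * B t + a * A t)

theorem hasDerivAt_one_add_rpow (e : ℝ) {t : ℝ} (ht : 0 < 1 + t) :
    HasDerivAt (fun t : ℝ => (1 + t) ^ e) (e * (1 + t) ^ (e - 1)) t := by
  simpa using ((hasDerivAt_id t).const_add 1).rpow_const (p := e) (Or.inl ht.ne')

theorem continuousOn_one_add_rpow (e T : ℝ) :
    ContinuousOn (fun t : ℝ => (1 + t) ^ e) (Ico 0 T) :=
  (by fun_prop : ContinuousOn (fun t : ℝ => 1 + t) (Ico 0 T)).rpow_const
    fun _ ht => Or.inl (add_pos_of_pos_of_nonneg one_pos ht.1).ne'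

/-- A phase close to `s` with `phase' ^ 2 - phase'' ≤ 1 - 1 / (4 (1 + s) ^ 2)`, so that
`exp (-phase) (W' + phase' W)` is nondecreasing if `W'' ≥ (1 - 1 / (4 (1 + s) ^ 2)) W ≥ 0`. -/
noncomputable def phase (s : ℝ) : ℝ := s + (1 + s)⁻¹

theorem le_phase {s : ℝ} (hs : 0 ≤ s) : s ≤ phase s :=
  le_add_of_nonneg_right (inv_nonneg.2 (add_nonneg zero_le_one hs))

theorem phase_le {s : ℝ} (hs : 0 ≤ s) : phase s ≤ s + 1 :=
  add_le_add_right (inv_le_one_of_one_le₀ (le_add_of_nonneg_right hs)) s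

theorem hasDerivAt_phase {s : ℝ} (hs : 0 ≤ s) : HasDerivAt phase (1 - 1 / (1 + s) ^ 2) s := by
  refine ((hasDerivAt_id s).add (((hasDerivAt_id s).const_add 1).inv
    (add_pos_of_pos_of_nonneg one_pos hs).ne')).congr_deriv ?_
  simp only [id]
  ring

theorem hasDerivAt_phase_slope {s : ℝ} (hs : 0 ≤ s) :
    HasDerivAt (fun s : ℝ => 1 - 1 / (1 + s) ^ 2) (2 / (1 + s) ^ 3) s := by
  have hs0 : 1 + s ≠ 0 := (add_pos_of_pos_of_nonneg one_pos hs).ne'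
  refine (((hasDerivAt_const s (1 : ℝ)).fun_div (((hasDerivAt_id s).const_add 1).fun_pow 2)
    (pow_ne_zero 2 hs0)).const_sub 1).congr_deriv ?_
  simp only [id]
  field_simp
  ring

section phase

variable {W V V' : ℝ → ℝ} {t₀ T z t : ℝ}

theorem mul_exp_phase_le (ht₀ : 0 ≤ t₀)
    (hW' : ∀ s ∈ Ico t₀ T, HasDerivAt W (V s) s) (hV' : ∀ s ∈ Ico t₀ T, HasDerivAt V (V' s) s)
    (hW : ∀ s ∈ Ico t₀ T, 0 ≤ W s)
    (hWV' : ∀ s ∈ Ico t₀ T, (1 - 1 / (4 * (1 + s) ^ 2)) * W s ≤ V' s)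
    (hz : z ≤ V t₀ + (1 - 1 / (1 + t₀) ^ 2) * W t₀) (ht : t ∈ Ico t₀ T) :
    z * Real.exp (-phase t₀) * Real.exp (phase t) ≤ V t + (1 - 1 / (1 + t) ^ 2) * W t := by
  have hsub : Icc t₀ t ⊆ Ico t₀ T := Icc_subset_Ico_right ht.2
  have hderiv (s : ℝ) (hs : s ∈ Icc t₀ t) :
      HasDerivAt (fun s => Real.exp (-phase s) * (V s + (1 - 1 / (1 + s) ^ 2) * W s))
        (Real.exp (-phase s)
          * (V' s + (2 / (1 + s) ^ 3 - (1 - 1 / (1 + s) ^ 2) ^ 2) * W s)) s := by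
    have hs0 := ht₀.trans hs.1
    refine ((hasDerivAt_phase hs0).neg.exp.mul ((hV' s (hsub hs)).add
      ((hasDerivAt_phase_slope hs0).mul (hW' s (hsub hs))))).congr_deriv ?_
    simp only [Pi.add_apply, Pi.mul_apply, Pi.neg_apply]
    ring
  have hmono := le_of_hasDerivAt_nonneg ht.1
    (fun s hs => (hderiv s hs).continuousAt.continuousWithinAt)
    (fun s hs => hderiv s (Ioo_subset_Icc_self hs)) fun s hs => ?_
  · have := mul_le_mul_of_nonneg_left hz (Real.exp_pos (-phase t₀)).le
    rw [← le_div_iff₀ (Real.exp_pos _), div_eq_mul_inv, ← Real.exp_neg]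
    linarith
  · have hs' := hsub (Ioo_subset_Icc_self hs)
    have hs0 : 0 < 1 + s := by linarith [hs'.1]
    have hcoef : 0 ≤ (1 - 1 / (4 * (1 + s) ^ 2))
        + (2 / (1 + s) ^ 3 - (1 - 1 / (1 + s) ^ 2) ^ 2) := by
      calc (0 : ℝ) ≤ (7 / 4 * (1 + s) ^ 2 + 2 * (1 + s) - 1) / (1 + s) ^ 4 :=
            div_nonneg (by nlinarith [hs'.1]) (by positivity)
        _ = _ := by field_simp; ring
    refine mul_nonneg (Real.exp_pos _).le ?_
    linarith [mul_nonneg hcoef (hW s hs'), hWV' s hs']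

theorem exp_growth_of_le_deriv (ht₀ : 0 ≤ t₀)
    (hW' : ∀ s ∈ Ico t₀ T, HasDerivAt W (V s) s) (hV' : ∀ s ∈ Ico t₀ T, HasDerivAt V (V' s) s)
    (hW : ∀ s ∈ Ico t₀ T, 0 ≤ W s)
    (hWV' : ∀ s ∈ Ico t₀ T, (1 - 1 / (4 * (1 + s) ^ 2)) * W s ≤ V' s)
    (hz : 0 ≤ z) (hz₀ : z ≤ V t₀ + (1 - 1 / (1 + t₀) ^ 2) * W t₀)
    (ht : t₀ + 1 ≤ t) (htT : t < T) : z * Real.exp (-(t₀ + 4)) * Real.exp t ≤ W t := by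
  have hsub : Icc (t - 1) t ⊆ Ico t₀ T := fun r hr => ⟨by linarith [hr.1], hr.2.trans_lt htT⟩
  have hderiv (s : ℝ) (hs : s ∈ Icc (t - 1) t) : HasDerivAt (fun s => Real.exp (phase s) * W s)
      (Real.exp (phase s) * (V s + (1 - 1 / (1 + s) ^ 2) * W s)) s :=
    ((hasDerivAt_phase (ht₀.trans (hsub hs).1)).exp.mul (hW' s (hsub hs))).congr_deriv (by ring)
  have hstart : 0 ≤ Real.exp (phase (t - 1)) * W (t - 1) :=
    mul_nonneg (Real.exp_pos _).le (hW _ (hsub ⟨le_rfl, by linarith⟩))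
  have hgain := add_mul_le_of_le_hasDerivAt (sub_one_lt t).le
    (fun s hs => (hderiv s hs).continuousAt.continuousWithinAt)
    (fun s hs => hderiv s (Ioo_subset_Icc_self hs))
    (m := z * Real.exp (-phase t₀) * Real.exp (2 * (t - 1))) fun s hs => ?_
  · refine le_of_mul_le_mul_left ?_ (Real.exp_pos (phase t))
    calc Real.exp (phase t) * (z * Real.exp (-(t₀ + 4)) * Real.exp t)
        = z * Real.exp (phase t + (-(t₀ + 4) + t)) := by
          rw [Real.exp_add, Real.exp_add]
          ring
      _ ≤ z * Real.exp (-phase t₀ + 2 * (t - 1)) := by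
          refine mul_le_mul_of_nonneg_left (Real.exp_le_exp.2 ?_) hz
          linarith [phase_le ht₀, phase_le (show 0 ≤ t by linarith)]
      _ = z * Real.exp (-phase t₀) * Real.exp (2 * (t - 1)) := by rw [Real.exp_add, mul_assoc]
      _ ≤ Real.exp (phase t) * W t := by linarith
  · have hs' := hsub (Ioo_subset_Icc_self hs)
    calc z * Real.exp (-phase t₀) * Real.exp (2 * (t - 1))
        ≤ z * Real.exp (-phase t₀) * Real.exp (phase s + phase s) := by
          refine mul_le_mul_of_nonneg_left (Real.exp_le_exp.2 ?_) (by positivity)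
          linarith [le_phase (ht₀.trans hs'.1), hs.1]
      _ = Real.exp (phase s) * (z * Real.exp (-phase t₀) * Real.exp (phase s)) := by
          rw [Real.exp_add]
          ring
      _ ≤ Real.exp (phase s) * (V s + (1 - 1 / (1 + s) ^ 2) * W s) := by
          gcongr
          exact mul_exp_phase_le ht₀ hW' hV' hW hWV' hz₀ hs'

end phase

namespace MomentSystem

variable {μ₁ μ₂ k T a κ m₀ t : ℝ} {A B N : ℝ → ℝ}

theorem hasDerivAt_rpow_mul (h : MomentSystem μ₁ μ₂ k T A B N) (e : ℝ) (ht : t ∈ Ioo 0 T) :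
    HasDerivAt (fun t => (1 + t) ^ e * A t) (weightedFlux e (e - 1) A B t) t := by
  have ht0 : 0 < 1 + t := add_pos one_pos ht.1
  refine ((hasDerivAt_one_add_rpow e ht0).mul (h.hasDerivAt_left t ht)).congr_deriv ?_
  rw [weightedFlux, Real.rpow_sub_one ht0.ne']
  field_simp
  ring

theorem hasDerivAt_weightedFlux (h : MomentSystem μ₁ μ₂ k T A B N) (hs : a + κ = μ₁ - 1)
    (ht : t ∈ Ioo 0 T) :
    HasDerivAt (weightedFlux a κ A B)
      ((1 + t) ^ κ * (1 + t) * ((k + (a * κ - μ₂) / (1 + t) ^ 2) * A t + N t)) t := by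
  have ht0 : 0 < 1 + t := add_pos one_pos ht.1
  have hid : HasDerivAt (fun t : ℝ => 1 + t) 1 t := (hasDerivAt_id t).const_add 1
  refine ((hasDerivAt_one_add_rpow κ ht0).mul ((hid.mul (h.hasDerivAt_right t ht)).add
    ((h.hasDerivAt_left t ht).const_mul a))).congr_deriv ?_
  obtain rfl : μ₁ = a + κ + 1 := by linarith
  simp only [Pi.add_apply, Pi.mul_apply]
  rw [Real.rpow_sub_one ht0.ne']
  field_simp
  ring

theorem continuousOn_weightedFlux (h : MomentSystem μ₁ μ₂ k T A B N) (a κ : ℝ) :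
    ContinuousOn (weightedFlux a κ A B) (Ico 0 T) :=
  (continuousOn_one_add_rpow κ T).mul
    (((continuousOn_const.add continuousOn_id).mul h.continuousOn_right).add
      (continuousOn_const.mul h.continuousOn_left))

theorem nonneg_and_le_weightedFlux (h : MomentSystem μ₁ μ₂ k T A B N) (hs : a + κ = μ₁ - 1)
    (hm : a * κ = μ₂) (hk : 0 ≤ k) (hm₀ : 0 < m₀) (hA0 : 0 ≤ A 0) (hm₀_le : m₀ ≤ a * A 0 + B 0)
    (ht : t ∈ Ico 0 T) : 0 ≤ A t ∧ m₀ ≤ weightedFlux a κ A B t := by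
  have hsub : Icc 0 t ⊆ Ico 0 T := Icc_subset_Ico_right ht.2
  have hsub' : Ioo 0 t ⊆ Ioo 0 T := Ioo_subset_Ioo_right ht.2.le
  have hflux0 : weightedFlux a κ A B 0 = a * A 0 + B 0 := by
    simp [weightedFlux, add_comm]
  have hcompare := le_and_le_of_cooperative ht.1
    (((continuousOn_one_add_rpow a T).mul h.continuousOn_left).mono hsub)
    ((h.continuousOn_weightedFlux a κ).mono hsub)
    (fun r hr => h.hasDerivAt_rpow_mul a (hsub' hr))
    (fun r hr => h.hasDerivAt_weightedFlux hs (hsub' hr)) (fun r hr hpos => ?_)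
    (fun r hr hle => ?_) (by linarith)
  · simp only [Pi.mul_apply, add_zero, Real.one_rpow, one_mul] at hcompare
    exact ⟨nonneg_of_mul_nonneg_right (hA0.trans hcompare.1)
      (Real.rpow_pos_of_pos (by linarith [ht.1]) _), by linarith [hcompare.2]⟩
  · have hr0 : 0 < 1 + r := add_pos one_pos hr.1
    have := pos_of_mul_pos_right hpos (Real.rpow_nonneg hr0.le κ)
    exact mul_nonneg (Real.rpow_nonneg hr0.le _) this.le
  · have hr0 : 0 < 1 + r := add_pos one_pos hr.1
    have hA : 0 ≤ A r := by
      simp only [Pi.mul_apply, add_zero, Real.one_rpow, one_mul] at hle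
      exact nonneg_of_mul_nonneg_right (hA0.trans hle) (Real.rpow_pos_of_pos hr0 _)
    have hN := h.nonneg r (hsub' hr)
    rw [hm, sub_self, zero_div, add_zero]
    positivity

/-- `W = (1 + t) ^ (μ₁ / 2) A` removes the damping: `W'' = (1 + (δ - 1) / (4 (1 + t) ^ 2)) W + ⋯`
with `δ = (a - κ) ^ 2`. -/
theorem mul_rpow_mul_le_of_nonneg (h : MomentSystem μ₁ μ₂ 1 T A B N) (hs : a + κ = μ₁ - 1)
    (hm : a * κ = μ₂) (hA : 0 ≤ A t) (ht : t ∈ Ioo 0 T) :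
    (1 - 1 / (4 * (1 + t) ^ 2)) * ((1 + t) ^ (μ₁ / 2) * A t)
      ≤ (1 + t) ^ (μ₁ / 2 - 1) * (1 + t)
          * ((1 + (μ₁ / 2 * (μ₁ / 2 - 1) - μ₂) / (1 + t) ^ 2) * A t + N t) := by
  have ht0 : 0 < 1 + t := add_pos one_pos ht.1
  have hdiscr : μ₁ / 2 * (μ₁ / 2 - 1) - μ₂ = ((a - κ) ^ 2 - 1) / 4 := by
    rw [← hm, show μ₁ = a + κ + 1 by linarith]
    ring
  have hcoef : 1 - 1 / (4 * (1 + t) ^ 2) ≤ 1 + (μ₁ / 2 * (μ₁ / 2 - 1) - μ₂) / (1 + t) ^ 2 := by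
    rw [hdiscr, ← sub_nonneg]
    calc (0 : ℝ) ≤ (a - κ) ^ 2 / (4 * (1 + t) ^ 2) := by positivity
      _ = _ := by field_simp; ring
  rw [← Real.rpow_add_one ht0.ne', sub_add_cancel, mul_left_comm]
  gcongr
  exact (mul_le_mul_of_nonneg_right hcoef hA).trans (le_add_of_nonneg_right (h.nonneg t ht))

theorem rpow_mul_weightedFlux_le (hs : a + κ = μ₁ - 1) (hκ : κ ≤ a) (ht : t = 1 + (a - κ))
    (hA : 0 ≤ A t) :
    (1 + t) ^ (μ₁ / 2 - 1 - κ) * weightedFlux a κ A B t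
      ≤ weightedFlux (μ₁ / 2) (μ₁ / 2 - 1) A B t
          + (1 - 1 / (1 + t) ^ 2) * ((1 + t) ^ (μ₁ / 2) * A t) := by
  have ht0 : 0 < 1 + t := by linarith
  have hweight : a ≤ μ₁ / 2 + (1 - 1 / (1 + t) ^ 2) * (1 + t) := by
    have : 1 / (1 + t) ≤ 1 := (div_le_one ht0).2 (by linarith)
    calc a ≤ μ₁ / 2 + ((1 + t) - 1 / (1 + t)) := by linarith
      _ = _ := by field_simp
  calc (1 + t) ^ (μ₁ / 2 - 1 - κ) * weightedFlux a κ A B t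
      = (1 + t) ^ (μ₁ / 2 - 1) * ((1 + t) * B t + a * A t) := by
        rw [weightedFlux, ← mul_assoc, ← Real.rpow_add ht0, sub_add_cancel]
    _ ≤ (1 + t) ^ (μ₁ / 2 - 1) * ((1 + t) * B t
          + (μ₁ / 2 + (1 - 1 / (1 + t) ^ 2) * (1 + t)) * A t) := by gcongr
    _ = _ := by
        rw [weightedFlux, Real.rpow_sub_one ht0.ne']
        field_simp
        ring

theorem exp_growth (h : MomentSystem μ₁ μ₂ 1 T A B N) (hs : a + κ = μ₁ - 1) (hm : a * κ = μ₂)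
    (hκ : κ ≤ a) (hm₀ : 0 < m₀) (hA0 : 0 ≤ A 0) (hm₀_le : m₀ ≤ a * A 0 + B 0)
    (ht : 2 + (a - κ) ≤ t) (htT : t < T) :
    (2 + (a - κ)) ^ (μ₁ / 2 - 1 - κ) * m₀ * Real.exp (-(5 + (a - κ))) * Real.exp t
      ≤ (1 + t) ^ (μ₁ / 2) * A t := by
  obtain ⟨t₀, ht₀⟩ : ∃ t₀, t₀ = 1 + (a - κ) := ⟨_, rfl⟩
  have hsub : Ico t₀ T ⊆ Ioo 0 T := fun s hs => ⟨by linarith [hs.1], hs.2⟩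
  have hpos {s : ℝ} (hst : s ∈ Ico t₀ T) : 0 ≤ A s ∧ m₀ ≤ weightedFlux a κ A B s :=
    h.nonneg_and_le_weightedFlux hs hm zero_le_one hm₀ hA0 hm₀_le (Ioo_subset_Ico_self (hsub hst))
  obtain ⟨hA, hflux⟩ := hpos (left_mem_Ico.2 (by linarith))
  have ht₀0 : 0 < 1 + t₀ := by linarith
  have hgrowth := exp_growth_of_le_deriv (by linarith)
    (fun s hs => h.hasDerivAt_rpow_mul (μ₁ / 2) (hsub hs))
    (fun s hs => h.hasDerivAt_weightedFlux (by ring) (hsub hs))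
    (fun s hs => mul_nonneg (Real.rpow_nonneg (by linarith [hs.1]) _) (hpos hs).1)
    (fun s hst => h.mul_rpow_mul_le_of_nonneg hs hm (hpos hst).1 (hsub hst))
    (z := (1 + t₀) ^ (μ₁ / 2 - 1 - κ) * m₀) (by positivity)
    ((mul_le_mul_of_nonneg_left hflux (Real.rpow_nonneg ht₀0.le _)).trans
      (rpow_mul_weightedFlux_le hs hκ ht₀ hA)) (by linarith : t₀ + 1 ≤ t) htT
  rwa [show 1 + t₀ = 2 + (a - κ) by rw [ht₀]; ring,
    show t₀ + 4 = 5 + (a - κ) by rw [ht₀]; ring] at hgrowth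

end MomentSystem

/-! ### Blow-up in logarithmic time -/

/-- The system `F' = D - b F`, `D' = P` over `(0, S)` with `F ≥ 0` and `D ≥ m`; the moment equation
takes this form in the time `τ = log (1 + t)`. -/
structure LogSystem (b m S : ℝ) (F D P : ℝ → ℝ) : Prop where
  continuousOn_left : ContinuousOn F (Ico 0 S)
  nonneg : ∀ τ ∈ Ico 0 S, 0 ≤ F τ
  le_right : ∀ τ ∈ Ico 0 S, m ≤ D τ
  hasDerivAt_left : ∀ τ ∈ Ioo 0 S, HasDerivAt F (D τ - b * F τ) τ
  hasDerivAt_right : ∀ τ ∈ Ioo 0 S, HasDerivAt D (P τ) τ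

theorem mapsTo_exp_sub_one_Ioo {T : ℝ} (hT : 0 < T) :
    MapsTo (fun τ => Real.exp τ - 1) (Ioo 0 (Real.log (1 + T))) (Ioo 0 T) :=
  fun _ hτ => ⟨sub_pos.2 (Real.one_lt_exp_iff.2 hτ.1),
    sub_lt_iff_lt_add'.2 ((Real.lt_log_iff_exp_lt (by linarith)).1 hτ.2)⟩

theorem mapsTo_exp_sub_one_Ico {T : ℝ} (hT : 0 < T) :
    MapsTo (fun τ => Real.exp τ - 1) (Ico 0 (Real.log (1 + T))) (Ico 0 T) :=
  fun _ hτ => ⟨sub_nonneg.2 (Real.one_le_exp hτ.1),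
    sub_lt_iff_lt_add'.2 ((Real.lt_log_iff_exp_lt (by linarith)).1 hτ.2)⟩

theorem MomentSystem.logSystem {μ₁ μ₂ T a κ m₀ : ℝ} {A B N : ℝ → ℝ}
    (h : MomentSystem μ₁ μ₂ 0 T A B N) (hs : a + κ = μ₁ - 1) (hm : a * κ = μ₂) (hm₀ : 0 < m₀)
    (hA0 : 0 ≤ A 0) (hm₀_le : m₀ ≤ a * A 0 + B 0) (hT : 0 < T) :
    LogSystem (a - κ) m₀ (Real.log (1 + T))
      (fun τ => Real.exp (κ * τ) * A (Real.exp τ - 1))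
      (fun τ => weightedFlux a κ A B (Real.exp τ - 1))
      (fun τ => Real.exp ((2 + κ) * τ) * N (Real.exp τ - 1)) := by
  have hexp (τ : ℝ) : HasDerivAt (fun τ => Real.exp τ - 1) (Real.exp τ) τ :=
    (Real.hasDerivAt_exp τ).sub_const 1
  have hflux {τ : ℝ} (hτ : τ ∈ Ico 0 (Real.log (1 + T))) :=
    h.nonneg_and_le_weightedFlux hs hm le_rfl hm₀ hA0 hm₀_le (mapsTo_exp_sub_one_Ico hT hτ)
  refine ⟨?_, fun τ hτ => mul_nonneg (Real.exp_pos _).le (hflux hτ).1, fun τ hτ => (hflux hτ).2,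
    fun τ hτ => ?_, fun τ hτ => ?_⟩
  · exact ContinuousOn.mul (by fun_prop)
      (h.continuousOn_left.comp (Continuous.continuousOn (by fun_prop))
        (mapsTo_exp_sub_one_Ico hT))
  · refine ((hasDerivAt_exp_mul κ τ).mul
      ((h.hasDerivAt_left _ (mapsTo_exp_sub_one_Ioo hT hτ)).comp τ (hexp τ))).congr_deriv ?_
    simp only [Function.comp_apply, weightedFlux, add_sub_cancel, ← Real.exp_mul, mul_comm τ κ]
    ring
  · refine ((h.hasDerivAt_weightedFlux hs (mapsTo_exp_sub_one_Ioo hT hτ)).comp τ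
      (hexp τ)).congr_deriv ?_
    rw [hm, sub_self, zero_div, zero_add, zero_mul, zero_add, add_sub_cancel, ← Real.exp_mul,
      show (2 + κ) * τ = τ * κ + τ + τ by ring, Real.exp_add, Real.exp_add]
    ring

theorem exp_neg_abs_mul_exp_le {γ σ τ L : ℝ} (h : |σ - τ| ≤ L) :
    Real.exp (-(|γ| * L)) * Real.exp (γ * τ) ≤ Real.exp (γ * σ) := by
  rw [← Real.exp_add]
  refine Real.exp_le_exp.2 ?_
  have : |γ * (σ - τ)| ≤ |γ| * L := by
    rw [abs_mul]
    gcongr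
  linarith [neg_le_of_abs_le this]

/-- The growth of `F` over a `LogSystem b 1`: linear without damping, bounded otherwise. -/
noncomputable def massGrowth (b τ : ℝ) : ℝ := if b = 0 then τ else 1

theorem massGrowth_pos {b τ : ℝ} (hτ : 0 < τ) : 0 < massGrowth b τ := by
  unfold massGrowth
  split_ifs
  exacts [hτ, one_pos]

theorem massGrowth_half_le {b σ τ : ℝ} (hτ : 2 ≤ τ) (h : τ - 1 ≤ σ) :
    massGrowth b τ / 2 ≤ massGrowth b σ := by
  unfold massGrowth
  split_ifs <;> linarith

namespace LogSystem

variable {b m S p γ c d σ τ : ℝ} {F D P : ℝ → ℝ}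

theorem le_of_large (hp : 1 < p) (hb : 0 ≤ b) (hc : 0 < c) :
    ∃ K : ℝ, 0 < K ∧ ∀ {m S : ℝ} {F D P : ℝ → ℝ}, LogSystem b m S F D P →
      (∀ τ ∈ Ioo 0 S, c * (Real.exp (γ * τ) * F τ ^ p) ≤ P τ) → ∀ τ₀, 0 < τ₀ →
      K * Real.exp (-(γ / (p - 1)) * τ₀) ≤ F τ₀ → K * Real.exp (-(γ / (p - 1)) * τ₀) ≤ D τ₀ →
        S ≤ τ₀ + 1 := by
  have hp1 : 0 < p - 1 := sub_pos.2 hp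
  set q := 2 / (p - 1)
  have : 0 < q := by positivity
  set C := q * (q + 1) + b * q
  set c' := c * Real.exp (-(|γ| * 1)) with hc'
  set Y₀ := (C / c') ^ (1 / (p - 1)) with hY₀
  have hY₀0 : 0 < Y₀ := by positivity
  refine ⟨Y₀ * (1 + q + b), by positivity, fun {m S F D P} h hP τ₀ hτ₀ hF hD => ?_⟩
  by_contra! hS
  set E := Real.exp (-(γ / (p - 1)) * τ₀) with hE
  have hEp : E ^ (p - 1) = Real.exp (-(γ * τ₀)) := by
    rw [hE, ← Real.exp_mul]
    field_simp
  have hY : c' * Real.exp (γ * τ₀) * (Y₀ * E) ^ (p - 1) = C := by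
    rw [Real.mul_rpow hY₀0.le (Real.exp_pos _).le, hEp, hY₀, ← Real.rpow_mul (by positivity),
      one_div_mul_cancel hp1.ne', Real.rpow_one, Real.exp_neg]
    have : c' ≠ 0 := by positivity
    field_simp
  have hsub : Icc (τ₀ + 1 - 1) (τ₀ + 1) ⊆ Ioo 0 S := fun τ hτ =>
    ⟨by linarith [hτ.1], hτ.2.trans_lt hS⟩
  have hY₀E : 0 < Y₀ * E * q := by positivity
  have hY₀Eb : 0 ≤ Y₀ * E * b := by positivity
  refine not_hasDerivAt_of_large (σ := τ₀ + 1) hp hb (c := c' * Real.exp (γ * τ₀)) (by positivity)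
    (mul_pos hY₀0 (Real.exp_pos _)) hY.ge (fun τ hτ => h.hasDerivAt_left τ (hsub hτ))
    (fun τ hτ => ?_) (by rw [add_sub_cancel_right]; linarith)
    (by rw [add_sub_cancel_right]; linarith [mul_pos hY₀0 (Real.exp_pos (-(γ / (p - 1)) * τ₀))])
    fun τ hτ => h.hasDerivAt_right τ (hsub hτ)
  have hF0 := h.nonneg τ (Ioo_subset_Ico_self (hsub hτ))
  refine le_trans ?_ (hP τ (hsub hτ))
  have hexp : Real.exp (-(|γ| * 1)) * Real.exp (γ * τ₀) ≤ Real.exp (γ * τ) :=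
    exp_neg_abs_mul_exp_le (abs_le.2 ⟨by linarith [hτ.1], by linarith [hτ.2]⟩)
  rw [abs_of_nonneg hF0, hc', mul_assoc c, mul_assoc c]
  gcongr

theorem le_left_of_le_right (h : LogSystem b m S F D P) (hb : 0 ≤ b) (hd : 0 ≤ d) (hσ : 0 ≤ σ)
    (hστ : σ ≤ τ) (hτ : τ < S) (hD : ∀ r ∈ Ioo σ τ, d ≤ D r) :
    Real.exp (b * (σ - τ)) * d * (τ - σ) ≤ F τ := by
  have hsub : Icc σ τ ⊆ Ico 0 S := fun r hr => ⟨hσ.trans hr.1, hr.2.trans_lt hτ⟩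
  have hgain := add_mul_le_of_le_hasDerivAt (f := fun r => Real.exp (b * r) * F r)
    (f' := fun r => Real.exp (b * r) * D r) (m := Real.exp (b * σ) * d) hστ
    (ContinuousOn.mul (by fun_prop) (h.continuousOn_left.mono hsub)) (fun r hr => ?_)
    fun r hr => ?_
  · have hF0 : 0 ≤ Real.exp (b * σ) * F σ :=
      mul_nonneg (Real.exp_pos _).le (h.nonneg σ (hsub (left_mem_Icc.2 hστ)))
    refine le_of_mul_le_mul_left ?_ (Real.exp_pos (b * τ))
    calc Real.exp (b * τ) * (Real.exp (b * (σ - τ)) * d * (τ - σ))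
        = Real.exp (b * σ) * d * (τ - σ) := by
          rw [← mul_assoc, ← mul_assoc, ← Real.exp_add]
          ring_nf
      _ ≤ Real.exp (b * τ) * F τ := by linarith
  · exact ((hasDerivAt_exp_mul b r).mul
      (h.hasDerivAt_left r ⟨hσ.trans_lt hr.1, hr.2.trans hτ⟩)).congr_deriv (by ring)
  · have := hD r hr
    have := hr.1.le
    gcongr

theorem le_right_of_le (h : LogSystem b m S F D P) (hm : 0 ≤ m) (hτ : 1 < τ) (hτS : τ < S)
    (hP : ∀ r ∈ Ioo (τ - 1) τ, d ≤ P r) : d ≤ D τ := by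
  have hsub : Icc (τ - 1) τ ⊆ Ioo 0 S := fun r hr => ⟨by linarith [hr.1], hr.2.trans_lt hτS⟩
  have hgain := add_mul_le_of_le_hasDerivAt (sub_one_lt τ).le
    (fun r hr => (h.hasDerivAt_right r (hsub hr)).continuousAt.continuousWithinAt)
    (fun r hr => h.hasDerivAt_right r (hsub (Ioo_subset_Icc_self hr))) hP
  have hstart := h.le_right (τ - 1) (Ioo_subset_Ico_self (hsub ⟨le_rfl, (sub_one_lt τ).le⟩))
  linarith

theorem mul_massGrowth_le (h : LogSystem b m S F D P) (hb : 0 ≤ b) (hm : 0 ≤ m) (hτ : 1 ≤ τ)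
    (hτS : τ < S) : Real.exp (-b) * (m * massGrowth b τ) ≤ F τ := by
  obtain rfl | hb0 := eq_or_ne b 0
  · simpa [massGrowth] using h.le_left_of_le_right hb hm le_rfl (by linarith) hτS
      fun r hr => h.le_right r ⟨hr.1.le, hr.2.trans hτS⟩
  · simpa [massGrowth, hb0] using h.le_left_of_le_right hb hm (sub_nonneg.2 hτ) (by linarith) hτS
      fun r hr => h.le_right r ⟨by linarith [hr.1], hr.2.trans hτS⟩

theorem exp_mul_massGrowth_rpow_le (h : LogSystem b m S F D P) (hp : 0 ≤ p) (hb : 0 ≤ b)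
    (hc : 0 ≤ c) (hm : 0 ≤ m) (hP : ∀ τ ∈ Ioo 0 S, c * (Real.exp (γ * τ) * F τ ^ p) ≤ P τ)
    (hτ : 2 ≤ τ) (hτS : τ < S) :
    c * Real.exp (-(|γ| * 1)) * (Real.exp (-b) / 2) ^ p
        * (Real.exp (γ * τ) * (m * massGrowth b τ) ^ p) ≤ D τ := by
  have hgrowth : 0 ≤ m * massGrowth b τ := mul_nonneg hm (massGrowth_pos (by linarith)).le
  refine h.le_right_of_le hm (by linarith) hτS fun r hr =>
    le_trans ?_ (hP r ⟨by linarith [hr.1], hr.2.trans hτS⟩)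
  have hF : Real.exp (-b) / 2 * (m * massGrowth b τ) ≤ F r :=
    calc Real.exp (-b) / 2 * (m * massGrowth b τ)
        = Real.exp (-b) * (m * (massGrowth b τ / 2)) := by ring
      _ ≤ Real.exp (-b) * (m * massGrowth b r) := by
          have := massGrowth_half_le (b := b) hτ hr.1.le
          gcongr
      _ ≤ F r := h.mul_massGrowth_le hb hm (by linarith [hr.1]) (hr.2.trans hτS)
  have hexp : Real.exp (-(|γ| * 1)) * Real.exp (γ * τ) ≤ Real.exp (γ * r) :=
    exp_neg_abs_mul_exp_le (abs_le.2 ⟨by linarith [hr.1], by linarith [hr.2]⟩)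
  calc _ = c * ((Real.exp (-(|γ| * 1)) * Real.exp (γ * τ))
          * (Real.exp (-b) / 2 * (m * massGrowth b τ)) ^ p) := by
        rw [Real.mul_rpow (by positivity) hgrowth]
        ring
    _ ≤ _ := by gcongr

theorem le_of_heat (hp : 1 < p) (hb : 0 ≤ b) (hc : 0 < c) :
    ∃ K : ℝ, ∀ {m S : ℝ} {F D P : ℝ → ℝ}, 0 < m → LogSystem b m S F D P →
      (∀ τ ∈ Ioo 0 S, c * (Real.exp (γ * τ) * F τ ^ p) ≤ P τ) → ∀ τ₀, 2 ≤ τ₀ →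
      K ≤ m * massGrowth b τ₀ * Real.exp (γ / (p - 1) * τ₀) → S ≤ τ₀ + 1 := by
  have hp1 : 0 < p - 1 := sub_pos.2 hp
  obtain ⟨K, hK, hlarge⟩ := le_of_large (γ := γ) hp hb hc
  set c' := c * Real.exp (-(|γ| * 1)) * (Real.exp (-b) / 2) ^ p
  have hc'0 : 0 < c' := by positivity
  refine ⟨max (K / Real.exp (-b)) ((K / c') ^ p⁻¹),
    fun {m S F D P} hm h hP τ₀ hτ₀ hKX => ?_⟩
  set X := m * massGrowth b τ₀ * Real.exp (γ / (p - 1) * τ₀) with hX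
  have hX0 : 0 ≤ X := by
    have := massGrowth_pos (b := b) (by linarith : 0 < τ₀)
    positivity
  have hmass : m * massGrowth b τ₀ = X * Real.exp (-(γ / (p - 1)) * τ₀) := by
    rw [hX, mul_assoc, ← Real.exp_add, neg_mul, add_neg_cancel, Real.exp_zero, mul_one]
  have hKF : K ≤ Real.exp (-b) * X :=
    (div_le_iff₀' (Real.exp_pos _)).1 ((le_max_left _ _).trans hKX)
  have hKD : K ≤ c' * X ^ p := by
    rw [← div_le_iff₀' hc'0, ← Real.rpow_inv_le_iff_of_pos (by positivity) hX0 (by linarith)]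
    exact (le_max_right _ _).trans hKX
  by_contra! hS
  refine absurd (hlarge h hP τ₀ (by linarith) ?_ ?_) (not_le.2 hS)
  · calc _ ≤ Real.exp (-b) * X * Real.exp (-(γ / (p - 1)) * τ₀) := by gcongr
      _ = Real.exp (-b) * (m * massGrowth b τ₀) := by rw [hmass]; ring
      _ ≤ F τ₀ := h.mul_massGrowth_le hb hm.le (by linarith) (by linarith)
  · have hscale : Real.exp (γ * τ₀) * (m * massGrowth b τ₀) ^ p
        = X ^ p * Real.exp (-(γ / (p - 1)) * τ₀) := by
      rw [hmass, Real.mul_rpow hX0 (Real.exp_pos _).le, ← Real.exp_mul, mul_left_comm,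
        ← Real.exp_add]
      congr 2
      field_simp
      ring
    calc _ ≤ c' * X ^ p * Real.exp (-(γ / (p - 1)) * τ₀) := by gcongr
      _ = c' * (Real.exp (γ * τ₀) * (m * massGrowth b τ₀) ^ p) := by rw [hscale, mul_assoc]
      _ ≤ D τ₀ := h.exp_mul_massGrowth_rpow_le (by linarith) hb hc.le hm.le hP hτ₀ (by linarith)

theorem le_of_wave {β τ₁ : ℝ} (hp : 1 < p) (hb : 0 ≤ b) (hc : 0 < c) (hτ₁ : 0 ≤ τ₁) :
    ∃ K : ℝ, ∀ {m e S : ℝ} {F D P : ℝ → ℝ}, 0 ≤ m → 0 < e → LogSystem b m S F D P →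
      (∀ τ ∈ Ioo 0 S, c * (Real.exp (γ * τ) * F τ ^ p) ≤ P τ) →
      (∀ τ ∈ Ioo 0 S, τ₁ ≤ τ → e * Real.exp (β * τ) ≤ P τ) → ∀ τ₀, τ₁ + 3 ≤ τ₀ →
      K ≤ e * Real.exp ((β + γ / (p - 1)) * τ₀) → S ≤ τ₀ + 1 := by
  obtain ⟨K, -, hlarge⟩ := le_of_large (γ := γ) hp hb hc
  refine ⟨K / (Real.exp (-b) * Real.exp (-(|β| * 2))),
    fun {m e S F D P} hm he h hP hP' τ₀ hτ₀ hKe => ?_⟩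
  by_contra! hS
  set d := Real.exp (-(|β| * 2)) * (e * Real.exp (β * τ₀)) with hd
  have hD (τ : ℝ) (hτ : τ ∈ Icc (τ₀ - 1) τ₀) : d ≤ D τ := by
    refine h.le_right_of_le hm (by linarith [hτ.1]) (by linarith [hτ.2]) fun r hr =>
      le_trans ?_ (hP' r ⟨by linarith [hr.1, hτ.1], by linarith [hr.2, hτ.2]⟩
        (by linarith [hr.1, hτ.1]))
    rw [hd, mul_left_comm]
    exact mul_le_mul_of_nonneg_left (exp_neg_abs_mul_exp_le
      (abs_le.2 ⟨by linarith [hr.1, hτ.1], by linarith [hr.2, hτ.2]⟩)) he.le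
  have hKd : K * Real.exp (-(γ / (p - 1)) * τ₀) ≤ Real.exp (-b) * d := by
    rw [div_le_iff₀' (by positivity)] at hKe
    calc K * Real.exp (-(γ / (p - 1)) * τ₀)
        ≤ Real.exp (-b) * Real.exp (-(|β| * 2)) * (e * Real.exp ((β + γ / (p - 1)) * τ₀))
            * Real.exp (-(γ / (p - 1)) * τ₀) := by gcongr
      _ = Real.exp (-b) * Real.exp (-(|β| * 2)) * e * Real.exp ((β + γ / (p - 1)) * τ₀
            + -(γ / (p - 1)) * τ₀) := by rw [Real.exp_add]; ring
      _ = Real.exp (-b) * d := by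
          rw [hd, ← add_mul, add_neg_cancel_right]
          ring
  refine absurd (hlarge h hP τ₀ (by linarith) ?_ ?_) (not_le.2 hS)
  · refine hKd.trans ?_
    simpa using h.le_left_of_le_right hb (by positivity) (by linarith) (sub_one_lt τ₀).le
      (by linarith) fun r hr => hD r (Ioo_subset_Icc_self hr)
  · refine hKd.trans ((mul_le_of_le_one_left (by positivity) ?_).trans
      (hD τ₀ ⟨by linarith, le_rfl⟩))
    exact Real.exp_le_one_iff.2 (by linarith)

end LogSystem

/-! ### Averages of plane waves over directions -/

/-- The annulus `1 ≤ ‖y‖ ≤ 2`; averaging over the directions of its points stands in for averaging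
over the unit sphere. -/
def annulus (n : ℕ) : Set (Space n) :=
  Metric.closedBall 0 2 \ Metric.ball 0 1

theorem mem_annulus {n : ℕ} {y : Space n} : y ∈ annulus n ↔ 1 ≤ ‖y‖ ∧ ‖y‖ ≤ 2 := by
  simp [annulus, and_comm]

theorem measurableSet_annulus (n : ℕ) : MeasurableSet (annulus n) :=
  measurableSet_closedBall.diff measurableSet_ball

theorem volume_annulus_ne_top (n : ℕ) : volume (annulus n) ≠ ⊤ :=
  ((measure_mono sdiff_subset).trans_lt measure_closedBall_lt_top).ne

theorem volume_annulus_pos (n : ℕ) [NeZero n] : 0 < volume.real (annulus n) := by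
  refine ENNReal.toReal_pos ?_ (volume_annulus_ne_top n)
  have hopen : IsOpen (Metric.ball (0 : Space n) 2 \ Metric.closedBall 0 1) :=
    Metric.isOpen_ball.sdiff Metric.isClosed_closedBall
  have hne : (Metric.ball (0 : Space n) 2 \ Metric.closedBall 0 1).Nonempty := by
    refine ⟨EuclideanSpace.single 0 (3 / 2), ?_⟩
    simp only [Set.mem_sdiff, Metric.mem_ball, dist_zero_right, Metric.mem_closedBall,
      PiLp.norm_single]
    norm_num
  exact (hopen.measure_pos volume hne |>.trans_le (measure_mono
    (sdiff_subset_sdiff Metric.ball_subset_closedBall Metric.ball_subset_closedBall))).ne'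

theorem measurable_direction (n : ℕ) : Measurable fun y : Space n => ‖y‖⁻¹ • y :=
  measurable_norm.inv.smul measurable_id

theorem norm_direction {n : ℕ} {y : Space n} (hy : y ∈ annulus n) : ‖‖y‖⁻¹ • y‖ = 1 :=
  norm_smul_inv_norm (𝕜 := ℝ) (norm_pos_iff.1 (zero_lt_one.trans_le (mem_annulus.1 hy).1))

/-- The average of the plane waves `e ^ ⟪x, ω⟫` over the directions `ω = y / ‖y‖` of the points `y`
of the annulus. Each of them solves `Δw = w`, hence so does the average. -/
noncomputable def waveAverage {n : ℕ} (x : Space n) : ℝ :=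
  ∫ y in annulus n, Real.exp (inner ℝ x (‖y‖⁻¹ • y))

theorem measurable_waveAverage (n : ℕ) : Measurable (waveAverage (n := n)) := by
  have : Measurable fun z : Space n × Space n => Real.exp (inner ℝ z.1 (‖z.2‖⁻¹ • z.2)) :=
    Real.measurable_exp.comp (measurable_fst.inner ((measurable_direction n).comp measurable_snd))
  exact (this.stronglyMeasurable.integral_prod_right'
    (ν := volume.restrict (annulus n))).measurable

theorem waveAverage_nonneg {n : ℕ} (x : Space n) : 0 ≤ waveAverage x :=
  integral_nonneg fun _ => (Real.exp_pos _).le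

section Gaussian

variable {n : ℕ} (b : OrthonormalBasis (Fin n) ℝ (Space n))

theorem integrable_and_integral_gaussian_orthonormal {w : Fin n → ℝ} (hw : ∀ i, 0 < w i) :
    Integrable (fun y => Real.exp (-∑ i, w i * inner ℝ (b i) y ^ 2)) ∧
    ∫ y, Real.exp (-∑ i, w i * inner ℝ (b i) y ^ 2) = ∏ i, Real.sqrt (Real.pi / w i) := by
  have hmp : MeasurePreserving (fun y => WithLp.ofLp (b.repr y)) volume volume :=
    (PiLp.volume_preserving_ofLp (Fin n)).comp b.measurePreserving_repr
  have hme : MeasurableEmbedding (fun y => WithLp.ofLp (b.repr y)) :=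
    (MeasurableEquiv.toLp 2 (Fin n → ℝ)).symm.measurableEmbedding.comp
      b.measurableEquiv.measurableEmbedding
  have hprod : (fun y => Real.exp (-∑ i, w i * inner ℝ (b i) y ^ 2))
      = (fun z : Fin n → ℝ => ∏ i, Real.exp (-w i * z i ^ 2)) ∘
        fun y => WithLp.ofLp (b.repr y) := by
    ext y
    simp only [Function.comp, ← Real.exp_sum, b.repr_apply_apply, neg_mul, Finset.sum_neg_distrib]
  rw [hprod]
  constructor
  · exact (hmp.integrable_comp_emb hme).2
      (Integrable.fintype_prod fun i => integrable_exp_neg_mul_sq (hw i))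
  · refine (hmp.integral_comp hme (fun z : Fin n → ℝ => ∏ i, Real.exp (-w i * z i ^ 2))).trans ?_
    rw [integral_fintype_prod_volume_eq_prod (fun i (x : ℝ) => Real.exp (-w i * x ^ 2))]
    simp_rw [integral_gaussian]

variable [NeZero n]

theorem exists_orthonormalBasis_norm_smul (x : Space n) :
    ∃ b : OrthonormalBasis (Fin n) ℝ (Space n), ‖x‖ • b 0 = x := by
  obtain ⟨e, he, hx⟩ : ∃ e : Space n, ‖e‖ = 1 ∧ ‖x‖ • e = x := by
    by_cases hx : x = 0
    · exact ⟨EuclideanSpace.single 0 1, by simp, by simp [hx]⟩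
    · exact ⟨‖x‖⁻¹ • x, norm_smul_inv_norm (𝕜 := ℝ) hx, smul_inv_smul₀ (norm_ne_zero_iff.2 hx) x⟩
  obtain ⟨b, hb⟩ := Orthonormal.exists_orthonormalBasis_extension_of_card_eq (𝕜 := ℝ)
    (E := Space n) (ι := Fin n) (by simp) (v := fun _ => e) (s := {0})
    ⟨fun _ => he, fun i j hij => absurd (Subsingleton.elim i j) hij⟩
  exact ⟨b, by rw [hb 0 rfl, hx]⟩

/-- The Gaussian rates dominating the plane waves `e ^ ⟪x, ·⟫` on the annulus for `‖x‖ = r`: of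
order `1` in the direction of `x` and of order `1 + r` in the orthogonal directions. -/
noncomputable def gaussianRate (r : ℝ) (i : Fin n) : ℝ :=
  if i = 0 then 1 else (1 + r) / 8

theorem gaussianRate_pos {r : ℝ} (hr : 0 ≤ r) (i : Fin n) : 0 < gaussianRate r i := by
  unfold gaussianRate
  split_ifs <;> positivity

variable {b}

theorem exp_inner_direction_le {r : ℝ} (hr : 0 ≤ r) {y : Space n} (hy : y ∈ annulus n) :
    Real.exp (inner ℝ (r • b 0) (‖y‖⁻¹ • y)) ≤
      Real.exp (r + 9 / 2) * Real.exp (-∑ i, gaussianRate r i * inner ℝ (b i) y ^ 2) := by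
  obtain ⟨h1, h2⟩ := mem_annulus.1 hy
  rw [← Real.exp_add, Real.exp_le_exp]
  have hnorm := b.sum_sq_inner_right y
  rw [← Finset.add_sum_erase _ _ (Finset.mem_univ 0)] at hnorm ⊢
  have hsum : ∑ i ∈ Finset.univ.erase 0, gaussianRate r i * inner ℝ (b i) y ^ 2
      = (1 + r) / 8 * ∑ i ∈ Finset.univ.erase 0, inner ℝ (b i) y ^ 2 := by
    rw [Finset.mul_sum]
    refine Finset.sum_congr rfl fun i hi => ?_
    rw [gaussianRate, if_neg (Finset.ne_of_mem_erase hi)]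
  have hinner : inner ℝ (r • b 0) (‖y‖⁻¹ • y) = r * (inner ℝ (b 0) y / ‖y‖) := by
    rw [real_inner_smul_left, real_inner_smul_right, div_eq_inv_mul]
  rw [hsum, hinner, show gaussianRate r (0 : Fin n) = 1 from if_pos rfl]
  have hq : 0 ≤ ∑ i ∈ Finset.univ.erase 0, inner ℝ (b i) y ^ 2 :=
    Finset.sum_nonneg fun i _ => sq_nonneg _
  generalize ∑ i ∈ Finset.univ.erase 0, inner ℝ (b i) y ^ 2 = q at *
  generalize inner ℝ (b 0) y = z at *
  have hz : z / ‖y‖ ≤ 1 - q / 8 := by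
    have hpos : 0 < ‖y‖ := by linarith
    have hzy : z * ‖y‖ ≤ ‖y‖ ^ 2 - q / 2 := by nlinarith [sq_nonneg (z - ‖y‖)]
    have hqy : q * ‖y‖ ^ 2 ≤ q * 4 := mul_le_mul_of_nonneg_left (by nlinarith) hq
    rw [div_le_iff₀ hpos]
    refine le_of_mul_le_mul_right ?_ hpos
    nlinarith
  have hrz : r * (z / ‖y‖) ≤ r * (1 - q / 8) := by gcongr
  have hzq : z ^ 2 + q ≤ 4 := by rw [hnorm]; nlinarith
  nlinarith [sq_nonneg z]

theorem prod_sqrt_pi_div_gaussianRate {r : ℝ} (hr : 0 ≤ r) :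
    ∏ i : Fin n, Real.sqrt (Real.pi / gaussianRate r i) =
      Real.sqrt Real.pi * Real.sqrt (8 * Real.pi) ^ (n - 1) * (1 + r) ^ (-((n - 1 : ℝ) / 2)) := by
  have hother : ∀ i ∈ Finset.univ.erase (0 : Fin n), Real.sqrt (Real.pi / gaussianRate r i)
      = Real.sqrt (8 * Real.pi) * (1 + r) ^ (-(1 / 2) : ℝ) := by
    intro i hi
    rw [gaussianRate, if_neg (Finset.ne_of_mem_erase hi),
      show Real.pi / ((1 + r) / 8) = 8 * Real.pi / (1 + r) by field_simp,
      Real.sqrt_div (by positivity), Real.rpow_neg (by positivity), ← Real.sqrt_eq_rpow,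
      div_eq_mul_inv]
  rw [← Finset.mul_prod_erase _ _ (Finset.mem_univ (0 : Fin n)), Finset.prod_congr rfl hother,
    Finset.prod_const, Finset.card_erase_of_mem (Finset.mem_univ _), Finset.card_univ,
    Fintype.card_fin, mul_pow, ← Real.rpow_natCast (_ ^ _), ← Real.rpow_mul (by positivity),
    Nat.cast_sub NeZero.one_le, show gaussianRate r (0 : Fin n) = 1 from if_pos rfl, div_one,
    ← mul_assoc]
  congr 2
  push_cast
  ring

end Gaussian

/-- The decay factor comes from the directions orthogonal to `x`: only those within
`O(‖x‖ ^ (-1 / 2))` of the direction of `x` contribute. -/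
theorem waveAverage_le (n : ℕ) [NeZero n] : ∃ C : ℝ, 0 < C ∧ ∀ x : Space n,
    waveAverage x ≤ C * (Real.exp ‖x‖ * (1 + ‖x‖) ^ (-((n - 1 : ℝ) / 2))) := by
  refine ⟨Real.exp (9 / 2) * (Real.sqrt Real.pi * Real.sqrt (8 * Real.pi) ^ (n - 1)), by positivity,
    fun x => ?_⟩
  obtain ⟨b, hb⟩ := exists_orthonormalBasis_norm_smul x
  obtain ⟨hint, hval⟩ :=
    integrable_and_integral_gaussian_orthonormal b (gaussianRate_pos (norm_nonneg x))
  calc waveAverage x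
      ≤ ∫ y in annulus n, Real.exp (‖x‖ + 9 / 2) *
          Real.exp (-∑ i, gaussianRate ‖x‖ i * inner ℝ (b i) y ^ 2) := by
        refine integral_mono_of_nonneg (Eventually.of_forall fun _ => (Real.exp_pos _).le)
          (hint.const_mul _).integrableOn ?_
        filter_upwards [ae_restrict_mem (measurableSet_annulus n)] with y hy
        simpa only [hb] using exp_inner_direction_le (b := b) (norm_nonneg x) hy
    _ ≤ ∫ y, Real.exp (‖x‖ + 9 / 2) *
          Real.exp (-∑ i, gaussianRate ‖x‖ i * inner ℝ (b i) y ^ 2) :=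
        setIntegral_le_integral (hint.const_mul _) (Eventually.of_forall fun _ => by positivity)
    _ = _ := by
        rw [integral_const_mul, hval, prod_sqrt_pi_div_gaussianRate (norm_nonneg x), Real.exp_add]
        ring

theorem one_add_rpow_le_exp {s q : ℝ} (hs : 0 < s) (hq : 0 < q) :
    ∃ K : ℝ, 0 < K ∧ ∀ η : ℝ, 0 ≤ η → (1 + η) ^ s ≤ K * Real.exp (q * η) := by
  refine ⟨max 1 (s / q) ^ s, by positivity, fun η hη => ?_⟩
  have hbase : 1 + η ≤ max 1 (s / q) * Real.exp (q / s * η) := by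
    calc 1 + η ≤ max 1 (s / q) * (q / s * η + 1) := by
          have h2 : s / q * (q / s * η) = η := by field_simp
          have h3 : 0 ≤ q / s * η := by positivity
          nlinarith [le_max_left 1 (s / q), mul_le_mul_of_nonneg_right (le_max_right 1 (s / q)) h3]
      _ ≤ _ := by
          gcongr
          exact Real.add_one_le_exp _
  calc (1 + η) ^ s ≤ (max 1 (s / q) * Real.exp (q / s * η)) ^ s := by gcongr
    _ = _ := by
      rw [Real.mul_rpow (by positivity) (by positivity), ← Real.exp_mul]
      congr 2; field_simp

theorem rpow_le_of_ratio {β x y M : ℝ} (hx : 0 < x) (hy : 0 < y) (hxy : x ≤ M * y)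
    (hyx : y ≤ M * x) : x ^ β ≤ M ^ |β| * y ^ β := by
  have hM : 0 < M := pos_of_mul_pos_left (hx.trans_le hxy) hy.le
  rcases le_total 0 β with hβ | hβ
  · rw [abs_of_nonneg hβ, ← Real.mul_rpow hM.le hy.le]
    exact Real.rpow_le_rpow hx.le hxy hβ
  · rw [abs_of_nonpos hβ, Real.rpow_neg hM.le, ← Real.inv_rpow hM.le,
      ← Real.mul_rpow (by positivity) hy.le]
    refine Real.rpow_le_rpow_of_nonpos (by positivity) ?_ hβ
    rwa [inv_mul_le_iff₀ hM]

theorem continuousOn_exp_mul_one_add_rpow (q β : ℝ) :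
    ContinuousOn (fun y => Real.exp (q * y) * (1 + y) ^ β) (Ici 0) := by
  refine ContinuousOn.mul (by fun_prop) (ContinuousOn.rpow_const (by fun_prop) fun y hy => ?_)
  exact Or.inl (by linarith [mem_Ici.1 hy])

theorem integral_exp_mul_one_add_rpow_le (β : ℝ) {q : ℝ} (hq : 0 < q) :
    ∃ C : ℝ, 0 < C ∧ ∀ ρ : ℝ, 0 ≤ ρ →
      ∫ y in (0 : ℝ)..ρ, Real.exp (q * y) * (1 + y) ^ β ≤ C * ((1 + ρ) ^ β * Real.exp (q * ρ)) := by
  obtain ⟨K, hK, hKle⟩ := one_add_rpow_le_exp (s := |β| + 1) (q := q / 2) (by positivity)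
    (by positivity)
  refine ⟨K * (2 / q), by positivity, fun ρ hρ => ?_⟩
  have hpt : ∀ y ∈ Icc 0 ρ, Real.exp (q * y) * (1 + y) ^ β ≤
      (1 + ρ) ^ β * K * Real.exp (q / 2 * ρ) * Real.exp (q / 2 * y) := by
    intro y ⟨hy0, hyρ⟩
    calc Real.exp (q * y) * (1 + y) ^ β
        ≤ Real.exp (q * y) * ((1 + (ρ - y)) ^ |β| * (1 + ρ) ^ β) := by
          gcongr
          exact rpow_le_of_ratio (by positivity) (by positivity) (by nlinarith) (by nlinarith)
      _ ≤ Real.exp (q * y) * (K * Real.exp (q / 2 * (ρ - y)) * (1 + ρ) ^ β) := by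
          gcongr
          exact (Real.rpow_le_rpow_of_exponent_le (by linarith) (by linarith)).trans
            (hKle _ (by linarith))
      _ = (1 + ρ) ^ β * K * (Real.exp (q * y) * Real.exp (q / 2 * (ρ - y))) := by ring
      _ = (1 + ρ) ^ β * K * (Real.exp (q / 2 * ρ) * Real.exp (q / 2 * y)) := by
          rw [← Real.exp_add, ← Real.exp_add]; ring_nf
      _ = _ := by ring
  have hexp : ∫ y in (0 : ℝ)..ρ, Real.exp (q / 2 * y) ≤ 2 / q * Real.exp (q / 2 * ρ) := by
    rw [intervalIntegral.integral_comp_mul_left _ (by positivity), integral_exp, mul_zero,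
      smul_eq_mul, inv_div]
    gcongr
    linarith [Real.exp_pos 0]
  calc _ ≤ ∫ y in (0 : ℝ)..ρ, (1 + ρ) ^ β * K * Real.exp (q / 2 * ρ) * Real.exp (q / 2 * y) :=
        intervalIntegral.integral_mono_on hρ
          ((continuousOn_exp_mul_one_add_rpow q β).mono (by
            rw [uIcc_of_le hρ]; exact Icc_subset_Ici_self)).intervalIntegrable
          (Continuous.intervalIntegrable (by fun_prop) _ _) hpt
    _ ≤ (1 + ρ) ^ β * K * Real.exp (q / 2 * ρ) * (2 / q * Real.exp (q / 2 * ρ)) := by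
        rw [intervalIntegral.integral_const_mul]
        gcongr
    _ = K * (2 / q) * ((1 + ρ) ^ β * (Real.exp (q / 2 * ρ) * Real.exp (q / 2 * ρ))) := by ring
    _ = _ := by rw [← Real.exp_add, ← add_mul, add_halves]

theorem setIntegral_closedBall_fun_norm (n : ℕ) [NeZero n] (φ : ℝ → ℝ) {ρ : ℝ} (hρ : 0 ≤ ρ) :
    ∫ x in Metric.closedBall (0 : Space n) ρ, φ ‖x‖ =
      n * volume.real (Metric.ball (0 : Space n) 1) * ∫ y in (0 : ℝ)..ρ, y ^ (n - 1) * φ y := by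
  have hind : ∀ x : Space n, (Metric.closedBall (0 : Space n) ρ).indicator (fun x => φ ‖x‖) x =
      (Iic ρ).indicator φ ‖x‖ := fun x => by
    simp only [indicator, mem_Iic, Metric.mem_closedBall, dist_zero_right]
  rw [← integral_indicator measurableSet_closedBall]
  simp only [hind]
  rw [integral_fun_norm_addHaar volume, intervalIntegral.integral_of_le hρ, ← Ioi_inter_Iic,
    ← setIntegral_indicator measurableSet_Iic]
  simp only [smul_eq_mul, nsmul_eq_mul, finrank_euclideanSpace, Fintype.card_fin, indicator_apply,
    mul_ite, mul_zero]
  rw [mul_assoc]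

theorem pow_mul_exp_mul_one_add_rpow_le (n : ℕ) [NeZero n] (q : ℝ) {y : ℝ} (hy : 0 ≤ y) :
    y ^ (n - 1) * (Real.exp (q * y) * (1 + y) ^ (-((n - 1 : ℝ) / 2) * q)) ≤
      Real.exp (q * y) * (1 + y) ^ ((n - 1 : ℝ) * (1 - q / 2)) := by
  calc y ^ (n - 1) * (Real.exp (q * y) * (1 + y) ^ (-((n - 1 : ℝ) / 2) * q))
      ≤ (1 + y) ^ ((n - 1 : ℕ) : ℝ) *
          (Real.exp (q * y) * (1 + y) ^ (-((n - 1 : ℝ) / 2) * q)) := by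
        rw [Real.rpow_natCast]
        gcongr
        linarith
    _ = Real.exp (q * y) *
          ((1 + y) ^ ((n - 1 : ℕ) : ℝ) * (1 + y) ^ (-((n - 1 : ℝ) / 2) * q)) := by ring
    _ = _ := by
        rw [← Real.rpow_add (by positivity), Nat.cast_sub NeZero.one_le]
        congr 2; push_cast; ring

theorem waveAverage_rpow_le (n : ℕ) [NeZero n] {q : ℝ} (hq : 0 ≤ q) :
    ∃ C : ℝ, 0 < C ∧ ∀ x : Space n, waveAverage x ^ q ≤
      C * (Real.exp (q * ‖x‖) * (1 + ‖x‖) ^ (-((n - 1 : ℝ) / 2) * q)) := by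
  obtain ⟨C, hC, hle⟩ := waveAverage_le n
  refine ⟨C ^ q, by positivity, fun x => ?_⟩
  have := Real.rpow_le_rpow (waveAverage_nonneg x) (hle x) hq
  rwa [Real.mul_rpow hC.le (by positivity), Real.mul_rpow (Real.exp_pos _).le (by positivity),
    ← Real.exp_mul, ← Real.rpow_mul (by positivity), mul_comm ‖x‖ q] at this

theorem setIntegral_waveAverage_rpow_le (n : ℕ) [NeZero n] {q : ℝ} (hq : 0 < q) :
    ∃ C : ℝ, 0 < C ∧ ∀ ρ : ℝ, 0 ≤ ρ →
      ∫ x in Metric.closedBall (0 : Space n) ρ, waveAverage x ^ q ≤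
        C * ((1 + ρ) ^ ((n - 1 : ℝ) * (1 - q / 2)) * Real.exp (q * ρ)) := by
  obtain ⟨C₀, hC₀, hwave⟩ := waveAverage_rpow_le n hq.le
  obtain ⟨C, hC, hCle⟩ := integral_exp_mul_one_add_rpow_le ((n - 1 : ℝ) * (1 - q / 2)) hq
  have hcont := continuousOn_exp_mul_one_add_rpow q
  set φ : ℝ → ℝ := fun r => Real.exp (q * r) * (1 + r) ^ (-((n - 1 : ℝ) / 2) * q)
  set V := n * volume.real (Metric.ball (0 : Space n) 1)
  have hV : 0 < V := mul_pos (Nat.cast_pos.2 (NeZero.pos n))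
    (ENNReal.toReal_pos (Metric.measure_ball_pos _ _ one_pos).ne' measure_ball_lt_top.ne)
  refine ⟨C₀ * (V * C), by positivity, fun ρ hρ => ?_⟩
  have hsub : uIcc 0 ρ ⊆ Ici 0 := by
    rw [uIcc_of_le hρ]
    exact Icc_subset_Ici_self
  calc ∫ x in Metric.closedBall (0 : Space n) ρ, waveAverage x ^ q
      ≤ ∫ x in Metric.closedBall (0 : Space n) ρ, C₀ * φ ‖x‖ :=
        integral_mono_of_nonneg
          (Eventually.of_forall fun x => Real.rpow_nonneg (waveAverage_nonneg x) _)
          ((((hcont _).comp_continuous continuous_norm norm_nonneg).const_mul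
            C₀).continuousOn.integrableOn_compact (isCompact_closedBall _ _))
          (Eventually.of_forall hwave)
    _ = C₀ * (V * ∫ y in (0 : ℝ)..ρ, y ^ (n - 1) * φ y) := by
        rw [integral_const_mul, setIntegral_closedBall_fun_norm n φ hρ]
    _ ≤ C₀ * (V * ∫ y in (0 : ℝ)..ρ,
          Real.exp (q * y) * (1 + y) ^ ((n - 1 : ℝ) * (1 - q / 2))) := by
        gcongr
        exact intervalIntegral.integral_mono_on hρ
          (ContinuousOn.mul (by fun_prop) ((hcont _).mono hsub)).intervalIntegrable
          ((hcont _).mono hsub).intervalIntegrable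
          fun y hy => pow_mul_exp_mul_one_add_rpow_le n q hy.1
    _ ≤ C₀ * (V * (C * ((1 + ρ) ^ ((n - 1 : ℝ) * (1 - q / 2)) * Real.exp (q * ρ)))) := by
        gcongr
        exact hCle ρ hρ
    _ = _ := by ring

/-! ### Truncated plane waves -/

/-- A smooth cutoff equal to `1` on the ball of radius `ρ + 1`. -/
def cutoff (n : ℕ) (ρ : ℝ) (hρ : 0 ≤ ρ) : ContDiffBump (0 : Space n) :=
  ⟨ρ + 1, ρ + 2, by linarith, by linarith⟩

/-- The plane wave `e ^ ⟪x, ξ⟫` cut off smoothly outside the ball of radius `ρ + 1`, which makes it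
a test function. -/
noncomputable def planeWave {n : ℕ} (ρ : ℝ) (hρ : 0 ≤ ρ) (ξ x : Space n) : ℝ :=
  cutoff n ρ hρ x * Real.exp (inner ℝ x ξ)

section planeWave

variable {n : ℕ} {ρ : ℝ} (hρ : 0 ≤ ρ) (ξ : Space n)

theorem contDiff_planeWave : ContDiff ℝ ∞ (planeWave ρ hρ ξ) :=
  (cutoff n ρ hρ).contDiff.mul (contDiff_id.inner ℝ contDiff_const).exp

theorem hasCompactSupport_planeWave : HasCompactSupport (planeWave ρ hρ ξ) :=
  (cutoff n ρ hρ).hasCompactSupport.mul_right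

theorem memLp_planeWave (P : ℝ≥0∞) : MemLp (planeWave ρ hρ ξ) P :=
  (contDiff_planeWave hρ ξ).continuous.memLp_of_hasCompactSupport (hasCompactSupport_planeWave hρ ξ)

theorem planeWave_nonneg (x : Space n) : 0 ≤ planeWave ρ hρ ξ x :=
  mul_nonneg (cutoff n ρ hρ).nonneg (Real.exp_pos _).le

theorem planeWave_eq {x : Space n} (hx : ‖x‖ ≤ ρ + 1) :
    planeWave ρ hρ ξ x = Real.exp (inner ℝ x ξ) := by
  rw [planeWave, (cutoff n ρ hρ).one_of_mem_closedBall (by simpa [cutoff] using hx), one_mul]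

theorem planeWave_eventuallyEq {x : Space n} (hx : ‖x‖ < ρ + 1) :
    planeWave ρ hρ ξ =ᶠ[𝓝 x] fun x => Real.exp (inner ℝ x ξ) := by
  filter_upwards [continuous_norm.continuousAt.eventually_lt continuousAt_const hx] with y hy
  exact planeWave_eq hρ ξ hy.le

end planeWave

theorem laplacian_eq_sum_fderiv_fderiv {n : ℕ} {ψ : Space n → ℝ} (hψ : ContDiff ℝ 2 ψ)
    (x : Space n) :
    Laplacian.laplacian ψ x =
      ∑ i, fderiv ℝ (fun y => fderiv ℝ ψ y (EuclideanSpace.basisFun (Fin n) ℝ i)) x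
        (EuclideanSpace.basisFun (Fin n) ℝ i) := by
  rw [InnerProductSpace.laplacian_eq_iteratedFDeriv_orthonormalBasis ψ
    (EuclideanSpace.basisFun (Fin n) ℝ)]
  refine Finset.sum_congr rfl fun i _ => ?_
  have hd : DifferentiableAt ℝ (fderiv ℝ ψ) x :=
    (hψ.fderiv_right (m := 1) (by norm_num)).differentiable one_ne_zero x
  simp [iteratedFDeriv_two_apply, fderiv_clm_apply hd (differentiableAt_const _)]

theorem hasFDerivAt_exp_inner {n : ℕ} (ξ x : Space n) :
    HasFDerivAt (fun x => Real.exp (inner ℝ x ξ)) (Real.exp (inner ℝ x ξ) • innerSL ℝ ξ) x := by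
  simpa only [innerSL_apply_apply, real_inner_comm ξ] using ((innerSL ℝ ξ).hasFDerivAt (x := x)).exp

theorem laplacian_exp_inner {n : ℕ} (ξ x : Space n) :
    Laplacian.laplacian (fun x => Real.exp (inner ℝ x ξ)) x =
      ‖ξ‖ ^ 2 * Real.exp (inner ℝ x ξ) := by
  have hfd (e y : Space n) : fderiv ℝ (fun x => Real.exp (inner ℝ x ξ)) y e
      = inner ℝ ξ e * Real.exp (inner ℝ y ξ) := by
    simp [(hasFDerivAt_exp_inner ξ y).fderiv, mul_comm]
  have hfd₂ (e : Space n) :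
      fderiv ℝ (fun y => fderiv ℝ (fun x => Real.exp (inner ℝ x ξ)) y e) x e
        = inner ℝ e ξ ^ 2 * Real.exp (inner ℝ x ξ) := by
    simp_rw [hfd]
    rw [((hasFDerivAt_exp_inner ξ x).const_mul (inner ℝ ξ e)).fderiv]
    simp only [smul_apply, innerSL_apply_apply, smul_eq_mul, real_inner_comm ξ e]
    ring
  have hsmooth : ContDiff ℝ 2 fun x : Space n => Real.exp (inner ℝ x ξ) :=
    (contDiff_id.inner ℝ contDiff_const).exp
  rw [laplacian_eq_sum_fderiv_fderiv hsmooth]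
  simp_rw [hfd₂]
  rw [← Finset.sum_mul, (EuclideanSpace.basisFun (Fin n) ℝ).sum_sq_inner_right]

theorem laplacian_planeWave {n : ℕ} {ρ : ℝ} (hρ : 0 ≤ ρ) (ξ : Space n) {x : Space n}
    (hx : ‖x‖ ≤ ρ) : Laplacian.laplacian (planeWave ρ hρ ξ) x = ‖ξ‖ ^ 2 * planeWave ρ hρ ξ x := by
  rw [(InnerProductSpace.laplacian_congr_nhds
      (planeWave_eventuallyEq hρ ξ (by linarith))).eq_of_nhds,
    laplacian_exp_inner, planeWave_eq hρ ξ (by linarith)]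

/-! ### Pairings with spatial test functions -/

theorem integral_inner_gradient {n : ℕ} {w : Space n → ℝ} {G : Space n → Space n}
    (hw : MemLp w 2) (hG : MemLp G 2) (hwG : IsWeakGradient w G) {ψ : Space n → ℝ}
    (hψ : ContDiff ℝ ∞ ψ) (hψc : HasCompactSupport ψ) :
    ∫ x, inner ℝ (G x) (gradient ψ x) = - ∫ x, w x * Laplacian.laplacian ψ x := by
  set b := EuclideanSpace.basisFun (Fin n) ℝ
  have hψ₁ (i : Fin n) : ContDiff ℝ ∞ fun y => fderiv ℝ ψ y (b i) :=
    (hψ.fderiv_right (by norm_cast)).clm_apply contDiff_const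
  have hψ₁c (i : Fin n) : HasCompactSupport fun y => fderiv ℝ ψ y (b i) :=
    hψc.fderiv_apply ℝ (b i)
  have hψ₂ (i : Fin n) : Continuous fun x => fderiv ℝ (fun y => fderiv ℝ ψ y (b i)) x (b i) :=
    (((hψ₁ i).fderiv_right (m := ∞) (by norm_cast)).clm_apply contDiff_const).continuous
  have hinner (x : Space n) : inner ℝ (G x) (gradient ψ x)
      = ∑ i, inner ℝ (G x) (b i) * fderiv ℝ ψ x (b i) := by
    rw [← b.sum_inner_mul_inner]
    refine Finset.sum_congr rfl fun i _ => ?_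
    rw [real_inner_comm (gradient ψ x) (b i), gradient, InnerProductSpace.toDual_symm_apply]
  have hGi (i : Fin n) : Integrable fun x => inner ℝ (G x) (b i) * fderiv ℝ ψ x (b i) :=
    (hG.inner_const (b i)).integrable_mul
      ((hψ₁ i).continuous.memLp_of_hasCompactSupport (hψ₁c i) (p := 2))
  have hwi (i : Fin n) : Integrable
      fun x => w x * fderiv ℝ (fun y => fderiv ℝ ψ y (b i)) x (b i) :=
    hw.integrable_mul
      ((hψ₂ i).memLp_of_hasCompactSupport ((hψ₁c i).fderiv_apply ℝ (b i)) (p := 2))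
  simp_rw [hinner, laplacian_eq_sum_fderiv_fderiv (hψ.of_le (by norm_cast)), Finset.mul_sum]
  rw [integral_finsetSum _ fun i _ => hGi i, integral_finsetSum _ fun i _ => hwi i,
    ← Finset.sum_neg_distrib]
  refine Finset.sum_congr rfl fun i _ => ?_
  rw [hwG _ (hψ₁ i) (hψ₁c i) (b i), neg_neg]

theorem exists_continuousLinearMap_pairing {n : ℕ} {ψ : Space n → ℝ} (hψ : Continuous ψ)
    (hψc : HasCompactSupport ψ) :
    ∃ L : Lp ℝ 2 (volume : Measure (Space n)) →L[ℝ] ℝ, ∀ w, L w = ∫ x, w x * ψ x := by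
  have hmem : MemLp ψ 2 := hψ.memLp_of_hasCompactSupport hψc
  refine ⟨innerSL ℝ hmem.toLp, fun w => ?_⟩
  rw [innerSL_apply_apply, L2.inner_def]
  refine integral_congr_ae ?_
  filter_upwards [hmem.coeFn_toLp] with x hx
  simp [hx]

theorem tendsto_lpNorm_of_tendsto_eLpNorm_sub {α ι E : Type*} [MeasurableSpace α] {μ : Measure α}
    [NormedAddCommGroup E] {P : ℝ≥0∞} (hP : 1 ≤ P) {l : Filter ι} {w : ι → α → E} {w₀ : α → E}
    (hw : ∀ᶠ i in l, MemLp (w i) P μ) (hw₀ : MemLp w₀ P μ)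
    (h : Tendsto (fun i => eLpNorm (w i - w₀) P μ) l (𝓝 0)) :
    Tendsto (fun i => lpNorm (w i) P μ) l (𝓝 (lpNorm w₀ P μ)) := by
  rw [tendsto_iff_dist_tendsto_zero]
  refine squeeze_zero' (Eventually.of_forall fun _ => dist_nonneg) ?_
    ((ENNReal.tendsto_toReal ENNReal.zero_ne_top).comp h)
  filter_upwards [hw] with i hi
  rw [Function.comp_apply, toReal_eLpNorm (hi.sub hw₀).1, Real.dist_eq, abs_sub_le_iff]
  exact ⟨by linarith [lpNorm_le_lpNorm_add_lpNorm_sub' (f := w i) hw₀ hP],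
    by linarith [lpNorm_le_lpNorm_add_lpNorm_sub (f := w₀) hi hP]⟩

theorem integral_rpow_abs_mul_eq_lpNorm {α : Type*} [MeasurableSpace α] {μ : Measure α} {p : ℝ}
    (hp : 0 < p) {w ψ : α → ℝ} (hψ : ∀ x, 0 ≤ ψ x)
    (hmeas : AEStronglyMeasurable (fun x => ψ x ^ (1 / p) * w x) μ) :
    ∫ x, |w x| ^ p * ψ x ∂μ = lpNorm (fun x => ψ x ^ (1 / p) * w x) (ENNReal.ofReal p) μ ^ p := by
  rw [lpNorm_eq_integral_norm_rpow_toReal (by simpa using hp) ENNReal.ofReal_ne_top hmeas,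
    ENNReal.toReal_ofReal hp.le,
    Real.rpow_inv_rpow (integral_nonneg fun x => Real.rpow_nonneg (norm_nonneg _) _) hp.ne']
  refine integral_congr_ae (Eventually.of_forall fun x => ?_)
  have hroot : 0 ≤ ψ x ^ (1 / p) := Real.rpow_nonneg (hψ x) _
  simp only [norm_mul, Real.norm_eq_abs, abs_of_nonneg hroot]
  rw [Real.mul_rpow hroot (abs_nonneg _), ← Real.rpow_mul (hψ x), one_div_mul_cancel hp.ne',
    Real.rpow_one, mul_comm]

theorem ContinuousLpLoc.continuousAt_integral {n : ℕ} {p T : ℝ} (hp : 1 < p)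
    {u : ℝ → Space n → ℝ} (hu : ContinuousLpLoc p T u) {ψ : Space n → ℝ} (hψ : Continuous ψ)
    (hψc : HasCompactSupport ψ) (hψ0 : ∀ x, 0 ≤ ψ x) {t : ℝ} (ht : t ∈ Ioo 0 T) :
    ContinuousAt (fun s => ∫ x, |u s x| ^ p * ψ x) t := by
  have hp0 : 0 < p := by linarith
  set P := ENNReal.ofReal p
  set ν : Measure (Space n) := volume.restrict (tsupport ψ)
  set η : Space n → ℝ := fun x => ψ x ^ (1 / p)
  have hη : Continuous η := hψ.rpow_const fun x => Or.inr (by positivity)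
  obtain ⟨M, hM⟩ := hη.bounded_above_of_compact_support
    (hψc.comp_left (g := fun r : ℝ => r ^ (1 / p)) (Real.zero_rpow (by positivity)))
  have hle (w : Space n → ℝ) : ∀ᵐ x ∂ν, ‖η x * w x‖ ≤ M * ‖w x‖ :=
    Eventually.of_forall fun x => by rw [norm_mul]; gcongr; exact hM x
  have hnear : ∀ᶠ s in 𝓝 t, s ∈ Ioo 0 T := Ioo_mem_nhds ht.1 ht.2
  have hmem (s : ℝ) (hs : s ∈ Ioo 0 T) : MemLp (fun x => η x * u s x) P ν :=
    (hu _ hψc s hs).1.of_le_mul (hη.aestronglyMeasurable.mul (hu _ hψc s hs).1.1) (hle _)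
  have hdiff : Tendsto (fun s => eLpNorm ((fun x => η x * u s x) - fun x => η x * u t x) P ν)
      (𝓝 t) (𝓝 0) := by
    have hlim := ENNReal.Tendsto.const_mul (a := ENNReal.ofReal M) (hu _ hψc t ht).2
      (Or.inr ENNReal.ofReal_ne_top)
    rw [mul_zero] at hlim
    refine tendsto_of_tendsto_of_tendsto_of_le_of_le tendsto_const_nhds hlim
      (fun _ => zero_le) fun s => eLpNorm_le_mul_eLpNorm_of_ae_le_mul ?_ P
    simpa only [Pi.sub_apply, mul_sub] using hle (u s - u t)
  have hval (s : ℝ) (hs : s ∈ Ioo 0 T) :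
      ∫ x, |u s x| ^ p * ψ x = lpNorm (fun x => η x * u s x) P ν ^ p := by
    rw [← integral_rpow_abs_mul_eq_lpNorm hp0 hψ0 (hmem s hs).1]
    refine (setIntegral_eq_integral_of_forall_compl_eq_zero fun x hx => ?_).symm
    rw [image_eq_zero_of_notMem_tsupport hx, mul_zero]
  refine ContinuousAt.congr (f := fun s => lpNorm (fun x => η x * u s x) P ν ^ p) ?_
    (hnear.mono fun s hs => (hval s hs).symm)
  exact (tendsto_lpNorm_of_tendsto_eLpNorm_sub (by simpa [P] using hp.le)
    (hnear.mono hmem) (hmem t ht) hdiff).rpow_const (Or.inr hp0.le)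

theorem exists_isTestFunction {n : ℕ} {ψ : Space n → ℝ} (hψ : ContDiff ℝ ∞ ψ)
    (hψc : HasCompactSupport ψ) {t T : ℝ} (ht : 0 ≤ t) (htT : t < T) :
    ∃ η : ℝ → ℝ, IsTestFunction T (fun z : Space n × ℝ => ψ z.1 * η z.2) ∧
      ∀ s ∈ Icc 0 t, η s = 1 ∧ deriv η s = 0 := by
  set η : ContDiffBump (0 : ℝ) := ⟨(2 * t + T) / 3, (t + 2 * T) / 3, by linarith, by linarith⟩
  have hsupp : tsupport (fun z : Space n × ℝ => ψ z.1 * η z.2) ⊆ tsupport ψ ×ˢ tsupport η := by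
    refine closure_minimal (fun z hz => ?_) ((isClosed_tsupport _).prod (isClosed_tsupport _))
    have hz' : ψ z.1 * η z.2 ≠ 0 := hz
    exact ⟨subset_tsupport _ (left_ne_zero_of_mul hz'),
      subset_tsupport _ (right_ne_zero_of_mul hz')⟩
  refine ⟨η, ⟨(hψ.comp contDiff_fst).mul (η.contDiff.comp contDiff_snd), ?_, ?_⟩, ?_⟩
  · exact (hψc.isCompact.prod η.hasCompactSupport.isCompact).of_isClosed_subset
      (isClosed_tsupport _) hsupp
  · intro z hz
    have hz₂ := (hsupp hz).2
    rw [η.tsupport_eq, Metric.mem_closedBall, dist_zero_right] at hz₂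
    have hrOut : η.rOut = (t + 2 * T) / 3 := rfl
    linarith [le_abs_self z.2, Real.norm_eq_abs z.2]
  · intro s hs
    have hmem : s ∈ Metric.ball (0 : ℝ) η.rIn := by
      rw [Metric.mem_ball, dist_zero_right, Real.norm_eq_abs, abs_of_nonneg hs.1]
      have hrIn : η.rIn = (2 * t + T) / 3 := rfl
      linarith [hs.2]
    have hev := η.eventuallyEq_one_of_mem_ball hmem
    exact ⟨hev.eq_of_nhds, by rw [hev.deriv_eq]; simp⟩

/-! ### Moments of energy solutions -/

/-- The part of `IsEnergySolution` that concerns the moments `∫ u ψ` in space: the regularity of `u`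
and of `v = u_t`, the initial values, and the equation tested against functions of `x` alone, with
both space derivatives on the test function. -/
structure SpatialWeakSolution (n : ℕ) (μ₁ μ₂ p ε : ℝ) (f g : Space n → ℝ) (T : ℝ)
    (u v : ℝ → Lp ℝ 2 (volume : Measure (Space n))) : Prop where
  continuousOn_u : ContinuousOn u (Ico 0 T)
  continuousOn_v : ContinuousOn v (Ico 0 T)
  hasDerivAt : ∀ t ∈ Ioo 0 T, HasDerivAt u (v t) t
  continuousLpLoc : ContinuousLpLoc p T fun t => u t
  u_zero : u 0 =ᵐ[volume] fun x => ε * f x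
  v_zero : v 0 =ᵐ[volume] fun x => ε * g x
  intervalIntegrable : ∀ ψ : Space n → ℝ, ContDiff ℝ ∞ ψ → HasCompactSupport ψ → ∀ t ∈ Ico 0 T,
    IntervalIntegrable (fun s => ∫ x, |u s x| ^ p * ψ x) volume 0 t
  weak_eq : ∀ ψ : Space n → ℝ, ContDiff ℝ ∞ ψ → HasCompactSupport ψ → ∀ t ∈ Ico 0 T,
    (∫ x, v t x * ψ x) - ε * (∫ x, g x * ψ x)
      - (∫ s in (0 : ℝ)..t, ∫ x, u s x * Laplacian.laplacian ψ x)
      + (∫ s in (0 : ℝ)..t, μ₁ / (1 + s) * ∫ x, v s x * ψ x)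
      + (∫ s in (0 : ℝ)..t, μ₂ / (1 + s) ^ 2 * ∫ x, u s x * ψ x)
    = ∫ s in (0 : ℝ)..t, ∫ x, |u s x| ^ p * ψ x

theorem IsEnergySolution.exists_spatialWeakSolution {n : ℕ} {μ₁ μ₂ p ε T : ℝ} {f g : Space n → ℝ}
    {u : ℝ → Lp ℝ 2 (volume : Measure (Space n))} (hu : IsEnergySolution n μ₁ μ₂ p ε f g T u) :
    ∃ v, SpatialWeakSolution n μ₁ μ₂ p ε f g T u v := by
  obtain ⟨v, G, huc, -, hwG, huv, hvc, hloc, hu0, hv0, hweak⟩ := hu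
  refine ⟨v, huc, hvc, fun t ht => (huv t (Ioo_subset_Ico_self ht)).hasDerivAt
    (Ico_mem_nhds ht.1 ht.2), hloc, hu0, hv0, fun ψ hψ hψc t ht => ?_, fun ψ hψ hψc t ht => ?_⟩
  all_goals
    obtain ⟨η, hφ, hη⟩ := exists_isTestFunction hψ hψc ht.1 ht.2
    obtain ⟨hint, heq⟩ := hweak _ hφ t ht
    have hη_one {s : ℝ} (hs : s ∈ uIcc 0 t) : η s = 1 := (hη s (uIcc_of_le ht.1 ▸ hs)).1
  · refine IntervalIntegrable.congr (fun s hs => ?_) hint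
    simp only [hη_one (uIoc_subset_uIcc hs), mul_one]
  have hspace : ∫ s in (0 : ℝ)..t, ∫ x, (- (v s x * deriv (fun r => ψ x * η r) s)
      + inner ℝ (G s x) (gradient (fun y => ψ y * η s) x))
      = ∫ s in (0 : ℝ)..t, -∫ x, u s x * Laplacian.laplacian ψ x := by
    refine intervalIntegral.integral_congr fun s hs => ?_
    have hsI : s ∈ Icc 0 t := uIcc_of_le ht.1 ▸ hs
    simp only [deriv_const_mul_field, (hη s hsI).1, (hη s hsI).2, mul_zero, neg_zero, zero_add,
      mul_one]
    exact integral_inner_gradient (Lp.memLp _) (Lp.memLp _)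
      (hwG s ⟨hsI.1, hsI.2.trans_lt ht.2⟩) hψ hψc
  have hlower (a : ℝ → ℝ) (w : ℝ → Lp ℝ 2 (volume : Measure (Space n))) :
      ∫ s in (0 : ℝ)..t, ∫ x, a s * w s x * (ψ x * η s)
        = ∫ s in (0 : ℝ)..t, a s * ∫ x, w s x * ψ x := by
    refine intervalIntegral.integral_congr fun s hs => ?_
    simp only [hη_one hs, mul_one, mul_assoc, integral_const_mul]
  have hsource : ∫ s in (0 : ℝ)..t, ∫ x, |u s x| ^ p * (ψ x * η s)
      = ∫ s in (0 : ℝ)..t, ∫ x, |u s x| ^ p * ψ x :=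
    intervalIntegral.integral_congr fun s hs => by simp only [hη_one hs, mul_one]
  simp only [hη_one left_mem_uIcc, hη_one right_mem_uIcc, mul_one, mul_assoc ε, integral_const_mul]
    at heq
  rw [hspace, intervalIntegral.integral_neg, hlower (fun s => μ₁ / (1 + s)),
    hlower (fun s => μ₂ / (1 + s) ^ 2), hsource] at heq
  exact heq

namespace SpatialWeakSolution

variable {n : ℕ} {μ₁ μ₂ p ε T : ℝ} {f g : Space n → ℝ}
  {u v : ℝ → Lp ℝ 2 (volume : Measure (Space n))}

theorem integral_u_zero (h : SpatialWeakSolution n μ₁ μ₂ p ε f g T u v) (ψ : Space n → ℝ) :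
    ∫ x, u 0 x * ψ x = ε * ∫ x, f x * ψ x := by
  rw [← integral_const_mul]
  refine integral_congr_ae ?_
  filter_upwards [h.u_zero] with x hx
  rw [hx, mul_assoc]

theorem integral_v_zero (h : SpatialWeakSolution n μ₁ μ₂ p ε f g T u v) (ψ : Space n → ℝ) :
    ∫ x, v 0 x * ψ x = ε * ∫ x, g x * ψ x := by
  rw [← integral_const_mul]
  refine integral_congr_ae ?_
  filter_upwards [h.v_zero] with x hx
  rw [hx, mul_assoc]

section Moment

variable {R k : ℝ} {ψ : Space n → ℝ}

theorem integral_mul_laplacian (hsupp : SupportedInCone R T u)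
    (hlap : ∀ x, ‖x‖ ≤ T + R → Laplacian.laplacian ψ x = k * ψ x) {t : ℝ} (ht : t ∈ Ico 0 T) :
    ∫ x, u t x * Laplacian.laplacian ψ x = k * ∫ x, u t x * ψ x := by
  rw [← integral_const_mul]
  refine integral_congr_ae ?_
  filter_upwards [hsupp t ht] with x hx
  rcases le_or_gt ‖x‖ (t + R) with hle | hlt
  · rw [hlap x (by linarith [ht.2])]
    ring
  · rw [hx hlt]
    ring

variable (h : SpatialWeakSolution n μ₁ μ₂ p ε f g T u v) (hψ : ContDiff ℝ ∞ ψ)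
  (hψc : HasCompactSupport ψ)

include h hψ hψc

theorem continuousOn_integral_u : ContinuousOn (fun t => ∫ x, u t x * ψ x) (Ico 0 T) := by
  obtain ⟨L, hL⟩ := exists_continuousLinearMap_pairing hψ.continuous hψc
  simpa only [Function.comp_def, hL] using L.continuous.comp_continuousOn h.continuousOn_u

theorem continuousOn_integral_v : ContinuousOn (fun t => ∫ x, v t x * ψ x) (Ico 0 T) := by
  obtain ⟨L, hL⟩ := exists_continuousLinearMap_pairing hψ.continuous hψc
  simpa only [Function.comp_def, hL] using L.continuous.comp_continuousOn h.continuousOn_v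

theorem hasDerivAt_integral_u {t : ℝ} (ht : t ∈ Ioo 0 T) :
    HasDerivAt (fun t => ∫ x, u t x * ψ x) (∫ x, v t x * ψ x) t := by
  obtain ⟨L, hL⟩ := exists_continuousLinearMap_pairing hψ.continuous hψc
  simpa only [Function.comp_def, hL] using
    L.hasFDerivAt.comp_hasDerivAt t (h.hasDerivAt t ht)

theorem continuousOn_linearPart : ContinuousOn (fun s => k * (∫ x, u s x * ψ x)
    - μ₁ / (1 + s) * (∫ x, v s x * ψ x) - μ₂ / (1 + s) ^ 2 * ∫ x, u s x * ψ x) (Ico 0 T) := by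
  have hne (s : ℝ) (hs : s ∈ Ico 0 T) : 1 + s ≠ 0 := by linarith [hs.1]
  have hA := h.continuousOn_integral_u hψ hψc
  have hμ₁ : ContinuousOn (fun s : ℝ => μ₁ / (1 + s)) (Ico 0 T) :=
    continuousOn_const.div (by fun_prop) hne
  have hμ₂ : ContinuousOn (fun s : ℝ => μ₂ / (1 + s) ^ 2) (Ico 0 T) :=
    continuousOn_const.div (by fun_prop) fun s hs => pow_ne_zero 2 (hne s hs)
  exact ((continuousOn_const.mul hA).sub (hμ₁.mul (h.continuousOn_integral_v hψ hψc))).sub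
    (hμ₂.mul hA)

theorem integral_v_eq (hsupp : SupportedInCone R T u)
    (hlap : ∀ x, ‖x‖ ≤ T + R → Laplacian.laplacian ψ x = k * ψ x) {t : ℝ} (ht : t ∈ Ico 0 T) :
    ∫ x, v t x * ψ x = ε * (∫ x, g x * ψ x)
      + (∫ s in (0 : ℝ)..t, (k * (∫ x, u s x * ψ x) - μ₁ / (1 + s) * (∫ x, v s x * ψ x)
        - μ₂ / (1 + s) ^ 2 * ∫ x, u s x * ψ x))
      + ∫ s in (0 : ℝ)..t, ∫ x, |u s x| ^ p * ψ x := by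
  have hsub : uIcc 0 t ⊆ Ico 0 T := by
    rw [uIcc_of_le ht.1]
    exact fun s hs => ⟨hs.1, hs.2.trans_lt ht.2⟩
  have hne (s : ℝ) (hs : s ∈ uIcc 0 t) : 1 + s ≠ 0 := by linarith [(hsub hs).1]
  have hA := (h.continuousOn_integral_u hψ hψc).mono hsub
  have hB := (h.continuousOn_integral_v hψ hψc).mono hsub
  have hkA : IntervalIntegrable (fun s => k * ∫ x, u s x * ψ x) volume 0 t :=
    (continuousOn_const.mul hA).intervalIntegrable
  have hμB : IntervalIntegrable (fun s => μ₁ / (1 + s) * ∫ x, v s x * ψ x) volume 0 t :=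
    ((continuousOn_const.div (by fun_prop) hne).mul hB).intervalIntegrable
  have hμA : IntervalIntegrable (fun s => μ₂ / (1 + s) ^ 2 * ∫ x, u s x * ψ x) volume 0 t :=
    ((continuousOn_const.div (by fun_prop) fun s hs => pow_ne_zero 2 (hne s hs)).mul
      hA).intervalIntegrable
  have hlap_eq : ∫ s in (0 : ℝ)..t, ∫ x, u s x * Laplacian.laplacian ψ x
      = ∫ s in (0 : ℝ)..t, k * ∫ x, u s x * ψ x :=
    intervalIntegral.integral_congr fun s hs => integral_mul_laplacian hsupp hlap (hsub hs)
  have heq := h.weak_eq ψ hψ hψc t ht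
  rw [hlap_eq] at heq
  rw [intervalIntegral.integral_sub (hkA.sub hμB) hμA, intervalIntegral.integral_sub hkA hμB]
  linarith

theorem momentSystem (hp : 1 < p) (hψ₀ : ∀ x, 0 ≤ ψ x) (hsupp : SupportedInCone R T u)
    (hlap : ∀ x, ‖x‖ ≤ T + R → Laplacian.laplacian ψ x = k * ψ x) :
    MomentSystem μ₁ μ₂ k T (fun t => ∫ x, u t x * ψ x) (fun t => ∫ x, v t x * ψ x)
      (fun t => ∫ x, |u t x| ^ p * ψ x) where
  continuousOn_left := h.continuousOn_integral_u hψ hψc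
  continuousOn_right := h.continuousOn_integral_v hψ hψc
  hasDerivAt_left _ ht := h.hasDerivAt_integral_u hψ hψc ht
  hasDerivAt_right t ht := by
    have hmem : Ioo 0 T ∈ 𝓝 t := Ioo_mem_nhds ht.1 ht.2
    have hN : ContinuousOn (fun s => ∫ x, |u s x| ^ p * ψ x) (Ioo 0 T) := fun s hs =>
      (h.continuousLpLoc.continuousAt_integral hp hψ.continuous hψc hψ₀ hs).continuousWithinAt
    have hlin := h.continuousOn_linearPart (k := k) hψ hψc
    have hlin' := hlin.mono Ioo_subset_Ico_self
    have hsub : uIcc 0 t ⊆ Ico 0 T := by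
      rw [uIcc_of_le ht.1.le]
      exact fun s hs => ⟨hs.1, hs.2.trans_lt ht.2⟩
    have hderiv_lin := intervalIntegral.integral_hasDerivAt_right
      (hlin.mono hsub).intervalIntegrable (hlin'.stronglyMeasurableAtFilter isOpen_Ioo t ht)
      (hlin'.continuousAt hmem)
    have hderiv_N := intervalIntegral.integral_hasDerivAt_right
      (h.intervalIntegrable ψ hψ hψc t (Ioo_subset_Ico_self ht))
      (hN.stronglyMeasurableAtFilter isOpen_Ioo t ht) (hN.continuousAt hmem)
    refine ((hderiv_lin.const_add (ε * ∫ x, g x * ψ x)).add hderiv_N).congr_of_eventuallyEq ?_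
    filter_upwards [hmem] with s hs
    exact h.integral_v_eq hψ hψc hsupp hlap (Ioo_subset_Ico_self hs)
  nonneg _ _ := integral_nonneg fun x =>
    mul_nonneg (Real.rpow_nonneg (abs_nonneg _) _) (hψ₀ x)

end Moment

theorem momentSystem_planeWave (h : SpatialWeakSolution n μ₁ μ₂ p ε f g T u v) (hp : 1 < p)
    {R ρ : ℝ} (hsupp : SupportedInCone R T u) (hρ : 0 ≤ ρ) (hTR : T + R ≤ ρ) (ξ : Space n) :
    MomentSystem μ₁ μ₂ (‖ξ‖ ^ 2) T (fun t => ∫ x, u t x * planeWave ρ hρ ξ x)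
      (fun t => ∫ x, v t x * planeWave ρ hρ ξ x)
      (fun t => ∫ x, |u t x| ^ p * planeWave ρ hρ ξ x) :=
  h.momentSystem (contDiff_planeWave hρ ξ) (hasCompactSupport_planeWave hρ ξ) hp
    (planeWave_nonneg hρ ξ) hsupp fun _ hx => laplacian_planeWave hρ ξ (hx.trans hTR)

end SpatialWeakSolution

/-! ### Estimates on balls -/

theorem integral_mul_planeWave {n : ℕ} {ρ r : ℝ} (hρ : 0 ≤ ρ) (hr : r ≤ ρ + 1) {w : Space n → ℝ}
    (hsupp : ∀ᵐ x, r < ‖x‖ → w x = 0) (ξ : Space n) :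
    ∫ x, w x * planeWave ρ hρ ξ x
      = ∫ x in Metric.closedBall 0 r, w x * Real.exp (inner ℝ x ξ) := by
  rw [← integral_indicator measurableSet_closedBall]
  refine integral_congr_ae ?_
  filter_upwards [hsupp] with x hx
  by_cases hmem : x ∈ Metric.closedBall (0 : Space n) r
  · rw [indicator_of_mem hmem, planeWave_eq hρ ξ ((mem_closedBall_zero_iff.1 hmem).trans hr)]
  · rw [indicator_of_notMem hmem, hx (by simpa using hmem), zero_mul]

theorem rpow_abs_integral_mul_le {α : Type*} [MeasurableSpace α] {μ : Measure α} {p q : ℝ}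
    (hpq : p.HolderConjugate q) {w W : α → ℝ} (hw : MemLp w (ENNReal.ofReal p) μ)
    (hW : MemLp W (ENNReal.ofReal q) μ) (hW₀ : ∀ x, 0 ≤ W x) :
    |∫ x, w x * W x ∂μ| ^ p ≤ (∫ x, |w x| ^ p ∂μ) * (∫ x, W x ^ q ∂μ) ^ (p - 1) := by
  have hw_int : 0 ≤ ∫ x, |w x| ^ p ∂μ :=
    integral_nonneg fun x => Real.rpow_nonneg (abs_nonneg _) _
  have hW_int : 0 ≤ ∫ x, W x ^ q ∂μ := integral_nonneg fun x => Real.rpow_nonneg (hW₀ x) _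
  have holder : |∫ x, w x * W x ∂μ|
      ≤ (∫ x, |w x| ^ p ∂μ) ^ (1 / p) * (∫ x, W x ^ q ∂μ) ^ (1 / q) := by
    refine abs_integral_le_integral_abs.trans ?_
    simpa only [Real.norm_eq_abs, abs_mul, abs_of_nonneg (hW₀ _)] using
      integral_mul_norm_le_Lp_mul_Lq hpq hw hW
  have hexp : 1 / q * p = p - 1 := by
    rw [one_div, ← hpq.one_sub_inv, sub_mul, inv_mul_cancel₀ hpq.ne_zero, one_mul]
  calc |∫ x, w x * W x ∂μ| ^ p
      ≤ ((∫ x, |w x| ^ p ∂μ) ^ (1 / p) * (∫ x, W x ^ q ∂μ) ^ (1 / q)) ^ p :=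
        Real.rpow_le_rpow (abs_nonneg _) holder hpq.nonneg
    _ = _ := by
        rw [Real.mul_rpow (by positivity) (by positivity), ← Real.rpow_mul hw_int,
          ← Real.rpow_mul hW_int, one_div_mul_cancel hpq.ne_zero, Real.rpow_one, hexp]

theorem isFiniteMeasure_restrict_closedBall {n : ℕ} (r : ℝ) :
    IsFiniteMeasure (volume.restrict (Metric.closedBall (0 : Space n) r)) :=
  isFiniteMeasure_restrict.2 measure_closedBall_lt_top.ne

theorem rpow_abs_setIntegral_le (n : ℕ) {p R : ℝ} (hp : 1 < p) (hR : 1 ≤ R) :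
    ∃ C : ℝ, 0 < C ∧ ∀ {t : ℝ} {w : Space n → ℝ}, 0 ≤ t →
      MemLp w (ENNReal.ofReal p) (volume.restrict (Metric.closedBall 0 (t + R))) →
      |∫ x in Metric.closedBall 0 (t + R), w x| ^ p ≤
        C * ((1 + t) ^ (n * (p - 1)) * ∫ x in Metric.closedBall 0 (t + R), |w x| ^ p) := by
  set V := volume.real (Metric.closedBall (0 : Space n) 1)
  have hV : 0 < V := ENNReal.toReal_pos
    (Metric.measure_closedBall_pos volume _ one_pos).ne' measure_closedBall_lt_top.ne
  refine ⟨(R ^ n * V) ^ (p - 1), by positivity, fun {t w} ht hw => ?_⟩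
  have := isFiniteMeasure_restrict_closedBall (n := n) (t + R)
  have holder := rpow_abs_integral_mul_le (.conjExponent hp) hw
    (memLp_const 1) fun _ => zero_le_one
  have hvol : ∫ _ in Metric.closedBall (0 : Space n) (t + R), (1 : ℝ) ^ p.conjExponent
      ≤ R ^ n * V * (1 + t) ^ n := by
    rw [Real.one_rpow, setIntegral_const, smul_eq_mul, mul_one,
      Measure.addHaar_real_closedBall' volume _ (by linarith), finrank_euclideanSpace,
      Fintype.card_fin, mul_right_comm, ← mul_pow]
    gcongr
    nlinarith
  simp only [mul_one] at holder
  have : 0 ≤ ∫ x in Metric.closedBall 0 (t + R), |w x| ^ p :=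
    integral_nonneg fun x => Real.rpow_nonneg (abs_nonneg _) _
  have : 0 ≤ ∫ _ in Metric.closedBall (0 : Space n) (t + R), (1 : ℝ) ^ p.conjExponent :=
    integral_nonneg fun _ => Real.rpow_nonneg zero_le_one _
  calc |∫ x in Metric.closedBall 0 (t + R), w x| ^ p
      ≤ (∫ x in Metric.closedBall 0 (t + R), |w x| ^ p)
          * (R ^ n * V * (1 + t) ^ n) ^ (p - 1) := by
        refine holder.trans ?_
        gcongr
    _ = _ := by
        rw [Real.mul_rpow (by positivity) (by positivity), ← Real.rpow_natCast (1 + t) n,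
          ← Real.rpow_mul (by positivity)]
        ring

theorem memLp_waveAverage {n : ℕ} [NeZero n] (r : ℝ) (P : ℝ≥0∞) :
    MemLp (waveAverage (n := n)) P (volume.restrict (Metric.closedBall 0 r)) := by
  obtain ⟨C, hC, hle⟩ := waveAverage_le n
  have := isFiniteMeasure_restrict_closedBall (n := n) r
  have hn : (0 : ℝ) ≤ n - 1 := sub_nonneg.2 (by exact_mod_cast NeZero.one_le)
  refine MemLp.of_bound (measurable_waveAverage n).aestronglyMeasurable (C * (Real.exp r * 1)) ?_
  filter_upwards [ae_restrict_mem measurableSet_closedBall] with x hx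
  have hxr : ‖x‖ ≤ r := by simpa using hx
  have hdecay : (1 + ‖x‖) ^ (-((n - 1 : ℝ) / 2)) ≤ 1 :=
    Real.rpow_le_one_of_one_le_of_nonpos (by linarith [norm_nonneg x]) (by linarith)
  rw [Real.norm_of_nonneg (waveAverage_nonneg x)]
  exact (hle x).trans (by gcongr)

theorem rpow_abs_setIntegral_mul_waveAverage_le (n : ℕ) [NeZero n] {p R : ℝ} (hp : 1 < p)
    (hR : 0 ≤ R) :
    ∃ C : ℝ, 0 < C ∧ ∀ {t : ℝ} {w : Space n → ℝ}, 0 ≤ t →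
      MemLp w (ENNReal.ofReal p) (volume.restrict (Metric.closedBall 0 (t + R))) →
      |∫ x in Metric.closedBall 0 (t + R), w x * waveAverage x| ^ p ≤
        C * ((1 + t) ^ ((n - 1) * (p / 2 - 1)) * Real.exp (p * t) *
          ∫ x in Metric.closedBall 0 (t + R), |w x| ^ p) := by
  have hpq := Real.HolderConjugate.conjExponent hp
  set q := p.conjExponent
  obtain ⟨C, hC, hle⟩ := setIntegral_waveAverage_rpow_le n hpq.symm.pos
  obtain ⟨β, hβ⟩ : ∃ β, β = (n - 1 : ℝ) * (1 - q / 2) := ⟨_, rfl⟩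
  rw [← hβ] at hle
  obtain ⟨C', hC'⟩ : ∃ C', C' = C * ((1 + R) ^ |β| * Real.exp (q * R)) := ⟨_, rfl⟩
  have hC'_pos : 0 < C' := by rw [hC']; positivity
  refine ⟨C' ^ (p - 1), by positivity, fun {t w} ht hw => ?_⟩
  have hW : ∫ x in Metric.closedBall (0 : Space n) (t + R), waveAverage x ^ q
      ≤ C' * ((1 + t) ^ β * Real.exp (q * t)) := by
    have hratio : (1 + (t + R)) ^ β ≤ (1 + R) ^ |β| * (1 + t) ^ β :=
      rpow_le_of_ratio (by positivity) (by positivity) (by nlinarith) (by nlinarith)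
    calc _ ≤ C * ((1 + (t + R)) ^ β * Real.exp (q * (t + R))) := hle _ (by positivity)
      _ ≤ C * (((1 + R) ^ |β| * (1 + t) ^ β) * Real.exp (q * (t + R))) := by gcongr
      _ = _ := by rw [mul_add, Real.exp_add, hC']; ring
  have hW₀ : 0 ≤ ∫ x in Metric.closedBall (0 : Space n) (t + R), waveAverage x ^ q :=
    integral_nonneg fun x => Real.rpow_nonneg (waveAverage_nonneg x) _
  have hqp : q * (p - 1) = p := by
    rw [mul_sub, mul_one, hpq.symm.mul_eq_add, add_sub_cancel_left]
  have hβp : β * (p - 1) = (n - 1) * (p / 2 - 1) := by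
    rw [hβ]; linear_combination (-(n - 1 : ℝ) / 2) * hqp
  calc |∫ x in Metric.closedBall 0 (t + R), w x * waveAverage x| ^ p
      ≤ (∫ x in Metric.closedBall 0 (t + R), |w x| ^ p)
          * (C' * ((1 + t) ^ β * Real.exp (q * t))) ^ (p - 1) := by
        refine (rpow_abs_integral_mul_le hpq hw (memLp_waveAverage _ _)
          waveAverage_nonneg).trans ?_
        gcongr
    _ = _ := by
        rw [Real.mul_rpow hC'_pos.le (by positivity), Real.mul_rpow (by positivity) (by positivity),
          ← Real.rpow_mul (by positivity), hβp, ← Real.exp_mul, mul_right_comm q, hqp]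
        ring

theorem le_setIntegral_mul_waveAverage {n : ℕ} {r m : ℝ} {w : Space n → ℝ}
    (hw : IntegrableOn w (Metric.closedBall 0 r))
    (hm : ∀ ξ : Space n, ‖ξ‖ = 1 →
      m ≤ ∫ x in Metric.closedBall 0 r, w x * Real.exp (inner ℝ x ξ)) :
    volume.real (annulus n) * m ≤ ∫ x in Metric.closedBall 0 r, w x * waveAverage x := by
  have : IsFiniteMeasure (volume.restrict (annulus n)) :=
    isFiniteMeasure_restrict.2 (volume_annulus_ne_top n)
  set μ := volume.restrict (Metric.closedBall (0 : Space n) r)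
  set ν := volume.restrict (annulus n)
  have hexp : Measurable fun z : Space n × Space n => Real.exp (inner ℝ z.1 (‖z.2‖⁻¹ • z.2)) :=
    Real.measurable_exp.comp (measurable_fst.inner ((measurable_direction n).comp measurable_snd))
  have hbound : ∀ᵐ z ∂μ.prod ν, ‖Real.exp (inner ℝ z.1 (‖z.2‖⁻¹ • z.2))‖ ≤ Real.exp r := by
    rw [Measure.prod_restrict]
    filter_upwards [ae_restrict_mem (measurableSet_closedBall.prod (measurableSet_annulus n))]
      with z hz
    rw [Real.norm_of_nonneg (Real.exp_pos _).le, Real.exp_le_exp]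
    calc inner ℝ z.1 (‖z.2‖⁻¹ • z.2) ≤ ‖z.1‖ * ‖‖z.2‖⁻¹ • z.2‖ := real_inner_le_norm _ _
      _ = ‖z.1‖ := by rw [norm_direction hz.2, mul_one]
      _ ≤ r := mem_closedBall_zero_iff.1 hz.1
  have hint : Integrable (fun z : Space n × Space n =>
      w z.1 * Real.exp (inner ℝ z.1 (‖z.2‖⁻¹ • z.2))) (μ.prod ν) :=
    (hw.comp_fst ν).mul_bdd hexp.aestronglyMeasurable hbound
  calc volume.real (annulus n) * m = ∫ _ in annulus n, m := by
        rw [setIntegral_const, smul_eq_mul]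
    _ ≤ ∫ y in annulus n, ∫ x in Metric.closedBall 0 r,
          w x * Real.exp (inner ℝ x (‖y‖⁻¹ • y)) :=
        setIntegral_mono_on (integrable_const m) hint.integral_prod_right
          (measurableSet_annulus n) fun y hy => hm _ (norm_direction hy)
    _ = ∫ x in Metric.closedBall 0 r, w x * waveAverage x := by
        rw [← integral_integral_swap hint]
        simp only [integral_const_mul, waveAverage]

theorem exists_setIntegral_pos {n : ℕ} {h : Space n → ℝ} (hint : LocallyIntegrable h)
    (h₀ : ∀ᵐ x, 0 ≤ h x) (hpos : ¬ ∀ᵐ x, h x = 0) :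
    ∃ r : ℝ, 0 ≤ r ∧ 0 < ∫ x in Metric.closedBall (0 : Space n) r, h x := by
  by_contra! hle
  apply hpos
  have hzero (k : ℕ) : ∀ᵐ x, x ∈ Metric.closedBall (0 : Space n) k → h x = 0 :=
    (ae_restrict_iff' measurableSet_closedBall).1 <|
      (setIntegral_eq_zero_iff_of_nonneg_ae (ae_restrict_of_ae h₀)
        (hint.integrableOn_isCompact (isCompact_closedBall _ _))).1
        ((hle k k.cast_nonneg).antisymm (integral_nonneg_of_ae (ae_restrict_of_ae h₀)))
  filter_upwards [ae_all_iff.2 hzero] with x hx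
  obtain ⟨k, hk⟩ := exists_nat_ge ‖x‖
  exact hx k (by simpa using hk)

theorem setIntegral_le_integral_planeWave {n : ℕ} {h : Space n → ℝ} (hint : MemLp h 2)
    (h₀ : ∀ᵐ x, 0 ≤ h x) {r ρ : ℝ} (hρ : 0 ≤ ρ) (hr : r ≤ ρ) {ξ : Space n} (hξ : ‖ξ‖ ≤ 1) :
    Real.exp (-r) * ∫ x in Metric.closedBall (0 : Space n) r, h x ≤
      ∫ x, h x * planeWave ρ hρ ξ x := by
  have hψ : Integrable fun x => h x * planeWave ρ hρ ξ x :=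
    hint.integrable_mul (memLp_planeWave hρ ξ 2)
  have hball : IntegrableOn h (Metric.closedBall 0 r) :=
    (hint.locallyIntegrable one_le_two).integrableOn_isCompact (isCompact_closedBall _ _)
  rw [← integral_const_mul]
  refine (integral_mono_ae (hball.const_mul _) hψ.integrableOn ?_).trans
    (setIntegral_le_integral hψ ?_)
  · filter_upwards [ae_restrict_of_ae h₀, ae_restrict_mem measurableSet_closedBall] with x hx hmem
    have hxr : ‖x‖ ≤ r := by simpa using hmem
    have hinner : -r ≤ inner ℝ x ξ := by
      linarith [neg_le_of_abs_le (abs_real_inner_le_norm x ξ),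
        mul_le_of_le_one_right (norm_nonneg x) hξ]
    rw [planeWave_eq hρ ξ (by linarith), mul_comm]
    gcongr
  · filter_upwards [h₀] with x hx
    exact mul_nonneg hx (planeWave_nonneg hρ ξ x)

/-! ### Reduction to logarithmic time -/

theorem integral_mul_planeWave_zero {n : ℕ} {ρ r : ℝ} (hρ : 0 ≤ ρ) (hr : r ≤ ρ + 1)
    {w : Space n → ℝ} (hsupp : ∀ᵐ x, r < ‖x‖ → w x = 0) :
    ∫ x, w x * planeWave ρ hρ 0 x = ∫ x in Metric.closedBall 0 r, w x := by
  simp only [integral_mul_planeWave hρ hr hsupp, inner_zero_right, Real.exp_zero, mul_one]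

theorem integral_rpow_mul_planeWave_zero {n : ℕ} {p ρ r : ℝ} (hp : 1 < p) (hρ : 0 ≤ ρ)
    (hr : r ≤ ρ + 1) {w : Space n → ℝ} (hsupp : ∀ᵐ x, r < ‖x‖ → w x = 0) :
    ∫ x, |w x| ^ p * planeWave ρ hρ 0 x = ∫ x in Metric.closedBall 0 r, |w x| ^ p := by
  refine integral_mul_planeWave_zero hρ hr ?_
  filter_upwards [hsupp] with x hx hxr
  rw [hx hxr, abs_zero, Real.zero_rpow (by linarith)]

namespace SpatialWeakSolution

variable {n : ℕ} {μ₁ μ₂ p ε T R ρ r t a κ m₀ : ℝ} {f g : Space n → ℝ}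
  {u v : ℝ → Lp ℝ 2 (volume : Measure (Space n))}

theorem integral_u_zero_nonneg (h : SpatialWeakSolution n μ₁ μ₂ p ε f g T u v) (hε : 0 ≤ ε)
    (hf₀ : ∀ᵐ x, 0 ≤ f x) (hρ : 0 ≤ ρ) (ξ : Space n) : 0 ≤ ∫ x, u 0 x * planeWave ρ hρ ξ x := by
  rw [h.integral_u_zero]
  refine mul_nonneg hε (integral_nonneg_of_ae ?_)
  filter_upwards [hf₀] with x hx
  exact mul_nonneg hx (planeWave_nonneg hρ ξ x)

theorem le_initial_flux (h : SpatialWeakSolution n μ₁ μ₂ p ε f g T u v) (hε : 0 ≤ ε)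
    (hf : MemLp f 2) (hg : MemLp g 2) (h₀ : ∀ᵐ x, 0 ≤ a * f x + g x) (hρ : 0 ≤ ρ) (hr : r ≤ ρ)
    {ξ : Space n} (hξ : ‖ξ‖ ≤ 1) :
    ε * (Real.exp (-r) * ∫ x in Metric.closedBall 0 r, (a * f x + g x)) ≤
      a * (∫ x, u 0 x * planeWave ρ hρ ξ x) + ∫ x, v 0 x * planeWave ρ hρ ξ x := by
  have hψ := memLp_planeWave hρ ξ 2
  have hfψ : Integrable fun x => f x * planeWave ρ hρ ξ x := hf.integrable_mul hψ
  have hgψ : Integrable fun x => g x * planeWave ρ hρ ξ x := hg.integrable_mul hψ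
  calc _ ≤ ε * ∫ x, (a * f x + g x) * planeWave ρ hρ ξ x :=
        mul_le_mul_of_nonneg_left
          (setIntegral_le_integral_planeWave ((hf.const_mul a).add hg) h₀ hρ hr hξ) hε
    _ = _ := by
        rw [h.integral_u_zero, h.integral_v_zero]
        simp only [add_mul, mul_assoc]
        rw [integral_add (hfψ.const_mul a) hgψ, integral_const_mul]
        ring

theorem exists_rpow_integral_u_le (n : ℕ) (hp : 1 < p) (hR : 1 ≤ R) :
    ∃ C : ℝ, 0 < C ∧ ∀ {μ₁ μ₂ ε T ρ t : ℝ} {f g : Space n → ℝ}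
      {u v : ℝ → Lp ℝ 2 (volume : Measure (Space n))} (hρ : 0 ≤ ρ),
      SpatialWeakSolution n μ₁ μ₂ p ε f g T u v → SupportedInCone R T u → T + R ≤ ρ →
      t ∈ Ioo 0 T → |∫ x, u t x * planeWave ρ hρ 0 x| ^ p ≤
        C * ((1 + t) ^ (n * (p - 1)) * ∫ x, |u t x| ^ p * planeWave ρ hρ 0 x) := by
  obtain ⟨C, hC, hle⟩ := rpow_abs_setIntegral_le n hp hR
  refine ⟨C, hC, fun {μ₁ μ₂ ε T ρ t f g u v} hρ h hsupp hTR ht => ?_⟩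
  have hr : t + R ≤ ρ + 1 := by linarith [ht.2]
  have hsupp_t := hsupp t (Ioo_subset_Ico_self ht)
  rw [integral_mul_planeWave_zero hρ hr hsupp_t, integral_rpow_mul_planeWave_zero hp hρ hr hsupp_t]
  exact hle ht.1.le (h.continuousLpLoc _ (isCompact_closedBall 0 (t + R)) t ht).1

theorem exp_growth_integral_mul_waveAverage (h : SpatialWeakSolution n μ₁ μ₂ p ε f g T u v)
    (hs : a + κ = μ₁ - 1) (hm : a * κ = μ₂) (hκ : κ ≤ a) (hp : 1 < p)
    (hsupp : SupportedInCone R T u) (hρ : 0 ≤ ρ) (hTR : T + R ≤ ρ) (hm₀ : 0 < m₀)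
    (hdata : ∀ ξ : Space n, ‖ξ‖ = 1 → 0 ≤ (∫ x, u 0 x * planeWave ρ hρ ξ x) ∧
      m₀ ≤ a * (∫ x, u 0 x * planeWave ρ hρ ξ x) + ∫ x, v 0 x * planeWave ρ hρ ξ x)
    (ht : 2 + (a - κ) ≤ t) (htT : t < T) :
    volume.real (annulus n) * ((2 + (a - κ)) ^ (μ₁ / 2 - 1 - κ) * Real.exp (-(5 + (a - κ)))) * m₀
      * Real.exp t ≤
    (1 + t) ^ (μ₁ / 2) * |∫ x in Metric.closedBall 0 (t + R), u t x * waveAverage x| := by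
  have hX : 0 < (1 + t) ^ (μ₁ / 2) := Real.rpow_pos_of_pos (by linarith) _
  have hgrowth (ξ : Space n) (hξ : ‖ξ‖ = 1) :
      (2 + (a - κ)) ^ (μ₁ / 2 - 1 - κ) * m₀ * Real.exp (-(5 + (a - κ))) * Real.exp t
        / (1 + t) ^ (μ₁ / 2) ≤
      ∫ x in Metric.closedBall 0 (t + R), u t x * Real.exp (inner ℝ x ξ) := by
    have hsys := h.momentSystem_planeWave hp hsupp hρ hTR ξ
    rw [hξ, one_pow] at hsys
    rw [← integral_mul_planeWave hρ (by linarith) (hsupp t ⟨by linarith, htT⟩), div_le_iff₀' hX]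
    exact hsys.exp_growth hs hm hκ hm₀ (hdata ξ hξ).1 (hdata ξ hξ).2 ht htT
  have hint : IntegrableOn (u t) (Metric.closedBall 0 (t + R)) :=
    ((Lp.memLp (u t)).locallyIntegrable one_le_two).integrableOn_isCompact
      (isCompact_closedBall _ _)
  have haverage := (le_setIntegral_mul_waveAverage hint hgrowth).trans (le_abs_self _)
  rw [← mul_div_assoc, div_le_iff₀' hX] at haverage
  refine le_of_eq_of_le ?_ haverage
  ring

theorem exists_rpow_le_integral_rpow (n : ℕ) [NeZero n] (hs : a + κ = μ₁ - 1) (hm : a * κ = μ₂)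
    (hκ : κ ≤ a) (hp : 1 < p) (hR : 0 ≤ R) :
    ∃ C : ℝ, 0 < C ∧ ∀ {ε T ρ t m₀ : ℝ} {f g : Space n → ℝ}
      {u v : ℝ → Lp ℝ 2 (volume : Measure (Space n))} (hρ : 0 ≤ ρ),
      SpatialWeakSolution n μ₁ μ₂ p ε f g T u v → SupportedInCone R T u → T + R ≤ ρ → 0 < m₀ →
      (∀ ξ : Space n, ‖ξ‖ = 1 → 0 ≤ (∫ x, u 0 x * planeWave ρ hρ ξ x) ∧
        m₀ ≤ a * (∫ x, u 0 x * planeWave ρ hρ ξ x) + ∫ x, v 0 x * planeWave ρ hρ ξ x) →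
      2 + (a - κ) ≤ t → t < T → m₀ ^ p ≤
        C * ((1 + t) ^ ((n + μ₁ - 1) * p / 2 - (n - 1)) *
          ∫ x, |u t x| ^ p * planeWave ρ hρ 0 x) := by
  obtain ⟨C, hC, hle⟩ := rpow_abs_setIntegral_mul_waveAverage_le n hp hR
  obtain ⟨K, hK⟩ : ∃ K, K = volume.real (annulus n) *
      ((2 + (a - κ)) ^ (μ₁ / 2 - 1 - κ) * Real.exp (-(5 + (a - κ)))) := ⟨_, rfl⟩
  have hK_pos : 0 < K := by
    have : 0 < 2 + (a - κ) := by linarith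
    have := volume_annulus_pos n
    rw [hK]
    positivity
  refine ⟨C / K ^ p, by positivity,
    fun {ε T ρ t m₀ f g u v} hρ h hsupp hTR hm₀ hdata ht htT => ?_⟩
  have ht' : t ∈ Ioo 0 T := ⟨by linarith, htT⟩
  have h1t : 0 < 1 + t := by linarith [ht'.1]
  rw [integral_rpow_mul_planeWave_zero hp hρ (by linarith) (hsupp t (Ioo_subset_Ico_self ht'))]
  have hupper := hle ht'.1.le (h.continuousLpLoc _ (isCompact_closedBall 0 (t + R)) t ht').1
  have hlower := h.exp_growth_integral_mul_waveAverage hs hm hκ hp hsupp hρ hTR hm₀ hdata ht htT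
  rw [← hK] at hlower
  set I := |∫ x in Metric.closedBall 0 (t + R), u t x * waveAverage x|
  set N := ∫ x in Metric.closedBall 0 (t + R), |u t x| ^ p
  have hexponent : (1 + t) ^ (μ₁ / 2 * p) * (1 + t) ^ ((n - 1) * (p / 2 - 1))
      = (1 + t) ^ ((n + μ₁ - 1) * p / 2 - (n - 1)) := by
    rw [← Real.rpow_add h1t]
    congr 1
    ring
  rw [div_mul_eq_mul_div, le_div_iff₀' (by positivity), ← Real.mul_rpow hK_pos.le hm₀.le]
  refine le_of_mul_le_mul_right ?_ (Real.exp_pos (p * t))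
  calc (K * m₀) ^ p * Real.exp (p * t) = (K * m₀ * Real.exp t) ^ p := by
        rw [mul_comm p, Real.exp_mul, ← Real.mul_rpow (by positivity) (by positivity)]
    _ ≤ ((1 + t) ^ (μ₁ / 2) * I) ^ p := by gcongr
    _ = (1 + t) ^ (μ₁ / 2 * p) * I ^ p := by
        rw [Real.mul_rpow (by positivity) (abs_nonneg _), Real.rpow_mul h1t.le]
    _ ≤ (1 + t) ^ (μ₁ / 2 * p) *
          (C * ((1 + t) ^ ((n - 1) * (p / 2 - 1)) * Real.exp (p * t) * N)) := by gcongr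
    _ = _ := by
        rw [← hexponent]
        ring

end SpatialWeakSolution

theorem inv_mul_exp_mul_le {C M N e τ : ℝ} (s : ℝ) (hC : 0 < C)
    (h : M ≤ C * ((1 + (Real.exp τ - 1)) ^ e * N)) :
    C⁻¹ * (Real.exp ((s - e) * τ) * M) ≤ Real.exp (s * τ) * N := by
  rw [add_sub_cancel, ← Real.exp_mul] at h
  rw [inv_mul_le_iff₀ hC]
  calc Real.exp ((s - e) * τ) * M ≤ Real.exp ((s - e) * τ) * (C * (Real.exp (τ * e) * N)) := by
        gcongr
    _ = C * (Real.exp ((s - e) * τ + τ * e) * N) := by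
        rw [Real.exp_add]
        ring
    _ = C * (Real.exp (s * τ) * N) := by ring_nf

theorem IsEnergySolution.exists_logSystem {n : ℕ} [NeZero n] {μ₁ μ₂ p R a κ : ℝ}
    {f g : Space n → ℝ} (hs : a + κ = μ₁ - 1) (hm : a * κ = μ₂) (hκ : κ ≤ a) (hp : 1 < p)
    (hR : 1 ≤ R) (hf : MemLp f 2) (hg : MemLp g 2) (hf₀ : ∀ᵐ x, 0 ≤ f x)
    (h₀ : ∀ᵐ x, 0 ≤ a * f x + g x) (hpos : ¬ ∀ᵐ x, a * f x + g x = 0) :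
    ∃ c c' H τ₁ : ℝ, 0 < c ∧ 0 < c' ∧ 0 < H ∧ 0 ≤ τ₁ ∧
      ∀ {ε T : ℝ} {u : ℝ → Lp ℝ 2 (volume : Measure (Space n))}, 0 < ε → 0 < T →
        IsEnergySolution n μ₁ μ₂ p ε f g T u → SupportedInCone R T u → ∃ F D P : ℝ → ℝ,
          LogSystem (a - κ) (ε * H) (Real.log (1 + T)) F D P ∧
          (∀ τ ∈ Ioo 0 (Real.log (1 + T)),
            c * (Real.exp (gammaF p (n + κ) * τ) * F τ ^ p) ≤ P τ) ∧
          (∀ τ ∈ Ioo 0 (Real.log (1 + T)), τ₁ ≤ τ →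
            c' * ε ^ p * Real.exp ((1 + n + κ - (n + μ₁ - 1) * p / 2) * τ) ≤ P τ) := by
  have hint : LocallyIntegrable fun x => a * f x + g x :=
    ((hf.const_mul a).add hg).locallyIntegrable one_le_two
  obtain ⟨r₀, hr₀, hmass⟩ := exists_setIntegral_pos hint h₀ hpos
  set H := Real.exp (-r₀) * ∫ x in Metric.closedBall 0 r₀, (a * f x + g x)
  have hH : 0 < H := mul_pos (Real.exp_pos _) hmass
  obtain ⟨C, hC, hheat⟩ := SpatialWeakSolution.exists_rpow_integral_u_le n hp hR
  obtain ⟨C', hC', hwave⟩ := SpatialWeakSolution.exists_rpow_le_integral_rpow n hs hm hκ hp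
    (zero_le_one.trans hR)
  refine ⟨C⁻¹, H ^ p / C', H, Real.log (3 + (a - κ)), by positivity, by positivity, hH,
    Real.log_nonneg (by linarith), fun {ε T u} hε hT hu hsupp => ?_⟩
  obtain ⟨v, hv⟩ := hu.exists_spatialWeakSolution
  have hρ : 0 ≤ max r₀ (T + R) := hr₀.trans (le_max_left _ _)
  have hTR : T + R ≤ max r₀ (T + R) := le_max_right _ _
  set ρ := max r₀ (T + R)
  have hdata (ξ : Space n) (hξ : ‖ξ‖ ≤ 1) : 0 ≤ (∫ x, u 0 x * planeWave ρ hρ ξ x) ∧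
      ε * H ≤ a * (∫ x, u 0 x * planeWave ρ hρ ξ x) + ∫ x, v 0 x * planeWave ρ hρ ξ x :=
    ⟨hv.integral_u_zero_nonneg hε.le hf₀ hρ ξ,
      hv.le_initial_flux hε.le hf hg h₀ hρ (le_max_left _ _) hξ⟩
  have hεH : 0 < ε * H := mul_pos hε hH
  have hsys := hv.momentSystem_planeWave hp hsupp hρ hTR 0
  rw [norm_zero, zero_pow two_ne_zero] at hsys
  obtain ⟨hA0, hm₀⟩ := hdata 0 (by simp)
  have hlog := hsys.logSystem hs hm hεH hA0 hm₀ hT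
  refine ⟨_, _, _, hlog, fun τ hτ => ?_, fun τ hτ hτ₁ => ?_⟩
  · have hle := hheat hρ hv hsupp hTR (mapsTo_exp_sub_one_Ioo hT hτ)
    have hA := (hsys.nonneg_and_le_weightedFlux hs hm le_rfl hεH hA0 hm₀
      (Ioo_subset_Ico_self (mapsTo_exp_sub_one_Ioo hT hτ))).1
    rw [abs_of_nonneg hA] at hle
    refine le_of_eq_of_le ?_ (inv_mul_exp_mul_le (2 + κ) hC hle)
    rw [Real.mul_rpow (Real.exp_pos _).le hA, ← Real.exp_mul, ← mul_assoc (Real.exp _),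
      ← Real.exp_add, gammaF]
    ring_nf
  · have hτ₁' := (Real.log_le_iff_le_exp (by linarith)).1 hτ₁
    have hle := hwave hρ hv hsupp hTR hεH (fun ξ hξ => hdata ξ hξ.le)
      (by linarith : 2 + (a - κ) ≤ Real.exp τ - 1) (mapsTo_exp_sub_one_Ioo hT hτ).2
    refine le_of_eq_of_le ?_ (inv_mul_exp_mul_le (2 + κ) hC' hle)
    rw [Real.mul_rpow hε.le hH.le]
    ring_nf

/-! ### Exponents -/

theorem gammaF_pos_of_lt_fujitaExponent {p ν : ℝ} (hp : 1 < p)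
    (h : (p : EReal) < fujitaExponent ν) : 0 < gammaF p ν := by
  rw [gammaF]
  rw [fujitaExponent] at h
  split_ifs at h with hν
  · rw [EReal.coe_lt_coe_iff, ← sub_lt_iff_lt_add', lt_div_iff₀ hν] at h
    linarith
  · nlinarith

theorem sq_sub_sq_eq_mul_gammaS {p ν : ℝ} (hν : 1 < ν) :
    Real.sqrt (ν ^ 2 + 10 * ν - 7) ^ 2 - (2 * (ν - 1) * p - (ν + 1)) ^ 2
      = 4 * (ν - 1) * gammaS p ν := by
  rw [Real.sq_sqrt (by nlinarith), gammaS]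
  ring

theorem add_one_le_sqrt {ν : ℝ} (hν : 1 < ν) : ν + 1 ≤ Real.sqrt (ν ^ 2 + 10 * ν - 7) :=
  Real.le_sqrt_of_sq_le (by nlinarith)

theorem gammaS_pos_of_lt_straussExponent {p ν : ℝ} (hp : 1 < p)
    (h : (p : EReal) < straussExponent ν) : 0 < gammaS p ν := by
  rw [straussExponent] at h
  split_ifs at h with hν
  · rw [EReal.coe_lt_coe_iff, lt_div_iff₀ (by linarith)] at h
    have hsqrt := add_one_le_sqrt hν
    have hνp : 0 < (ν - 1) * p := mul_pos (by linarith) (by linarith)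
    have hfactor : 0 < 4 * (ν - 1) * gammaS p ν := by
      rw [← sq_sub_sq_eq_mul_gammaS hν, sq_sub_sq]
      exact mul_pos (by linarith) (by linarith)
    exact pos_of_mul_pos_right hfactor (by linarith)
  · rw [gammaS]
    nlinarith [mul_pos (sub_pos.2 hp) (sub_pos.2 hp)]

theorem dStar_nonneg (ν : ℝ) : 0 ≤ dStar ν := by
  rw [dStar]
  split_ifs with hν
  · linarith [add_one_le_sqrt hν]
  · exact le_rfl

theorem mul_dStar_le_of_lt_straussExponent {p ν : ℝ} (h : (p : EReal) < straussExponent ν) :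
    p * dStar ν ≤ 2 := by
  rw [straussExponent] at h
  by_cases hν : 1 < ν
  · rw [if_pos hν, EReal.coe_lt_coe_iff] at h
    rw [dStar, if_pos hν]
    have hsq := Real.sq_sqrt (show 0 ≤ ν ^ 2 + 10 * ν - 7 by nlinarith)
    have hle : 0 ≤ (-1 - ν + Real.sqrt (ν ^ 2 + 10 * ν - 7)) / 2 := by
      linarith [add_one_le_sqrt hν]
    generalize Real.sqrt (ν ^ 2 + 10 * ν - 7) = q at *
    calc p * ((-1 - ν + q) / 2) ≤ (ν + 1 + q) / (2 * (ν - 1)) * ((-1 - ν + q) / 2) :=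
          mul_le_mul_of_nonneg_right h.le hle
      _ = 2 := by
          have : ν - 1 ≠ 0 := by linarith
          field_simp
          linear_combination hsq
  · simp [dStar, hν]

theorem two_mul_gammaF_sub_gammaS (n : ℕ) (μ₁ δ p : ℝ) :
    2 * p * gammaF p (heatDim n μ₁ δ) - gammaS p (n + μ₁)
      = (p - 1) * (2 - p * (n - Real.sqrt δ)) := by
  rw [gammaF, gammaS, heatDim]
  ring

section Regimes

variable {n : ℕ} {μ₁ δ p : ℝ}

theorem gammaF_pos_of_mul_le (hp1 : 1 < p) (hp : (p : EReal) < blowupExponent n μ₁ δ)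
    (h : (p : EReal) < straussExponent (n + μ₁) → p * (n - Real.sqrt δ) ≤ 2) :
    0 < gammaF p (heatDim n μ₁ δ) := by
  rcases lt_max_iff.1 hp with hF | hS
  · exact gammaF_pos_of_lt_fujitaExponent hp1 hF
  · have hdiff : 0 ≤ (p - 1) * (2 - p * (n - Real.sqrt δ)) :=
      mul_nonneg (by linarith) (by linarith [h hS])
    have hγ : 0 < 2 * p * gammaF p (heatDim n μ₁ δ) := by
      linarith [gammaS_pos_of_lt_straussExponent hp1 hS, two_mul_gammaF_sub_gammaS n μ₁ δ p]
    exact pos_of_mul_pos_right hγ (by linarith)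

theorem gammaS_pos_of_le_mul (hp1 : 1 < p) (hp : (p : EReal) < blowupExponent n μ₁ δ)
    (h : 2 ≤ p * (n - Real.sqrt δ)) : 0 < gammaS p (n + μ₁) := by
  rcases lt_max_iff.1 hp with hF | hS
  · have hdiff : 0 ≤ (p - 1) * (p * (n - Real.sqrt δ) - 2) :=
      mul_nonneg (by linarith) (by linarith)
    have hγ : 0 < 2 * p * gammaF p (heatDim n μ₁ δ) :=
      mul_pos (by linarith) (gammaF_pos_of_lt_fujitaExponent hp1 hF)
    linarith [two_mul_gammaF_sub_gammaS n μ₁ δ p]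
  · exact gammaS_pos_of_lt_straussExponent hp1 hS

theorem gammaS_pos_of_le_sub_two (hp1 : 1 < p) (hp : (p : EReal) < blowupExponent n μ₁ δ)
    (h : Real.sqrt δ ≤ n - 2) : 0 < gammaS p (n + μ₁) :=
  gammaS_pos_of_le_mul hp1 hp (by nlinarith)

theorem gammaS_pos_of_div_lt (hp1 : 1 < p) (hp : (p : EReal) < blowupExponent n μ₁ δ)
    (h : Real.sqrt δ < n - dStar (n + μ₁)) (hlt : 2 / (n - Real.sqrt δ) < p) :
    0 < gammaS p (n + μ₁) :=
  gammaS_pos_of_le_mul hp1 hp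
    ((div_lt_iff₀ (by linarith [dStar_nonneg (n + μ₁)])).1 hlt).le

theorem gammaF_pos_of_le_div (hp1 : 1 < p) (hp : (p : EReal) < blowupExponent n μ₁ δ)
    (h : Real.sqrt δ < n - dStar (n + μ₁)) (hle : p ≤ 2 / (n - Real.sqrt δ)) :
    0 < gammaF p (heatDim n μ₁ δ) :=
  gammaF_pos_of_mul_le hp1 hp fun _ =>
    (le_div_iff₀ (by linarith [dStar_nonneg (n + μ₁)])).1 hle

theorem gammaF_pos_of_sub_dStar_le (hp1 : 1 < p) (hp : (p : EReal) < blowupExponent n μ₁ δ)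
    (h : n - dStar (n + μ₁) ≤ Real.sqrt δ) : 0 < gammaF p (heatDim n μ₁ δ) :=
  gammaF_pos_of_mul_le hp1 hp fun hS => calc
    p * (n - Real.sqrt δ) ≤ p * dStar (n + μ₁) := by gcongr; linarith
    _ ≤ 2 := mul_dStar_le_of_lt_straussExponent hS

end Regimes

/-! ### The heat-like time scale -/

theorem rpow_one_sub_sign {δ : ℝ} (hδ : 0 ≤ δ) (τ : ℝ) :
    τ ^ (1 - Real.sign δ) = massGrowth (Real.sqrt δ) τ := by
  rcases hδ.eq_or_lt with rfl | hδ
  · simp [massGrowth]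
  · simp [massGrowth, Real.sign_of_pos hδ, (Real.sqrt_pos.2 hδ).ne']

theorem monotone_massGrowth (b : ℝ) : Monotone (massGrowth b) := fun σ τ h => by
  unfold massGrowth
  split_ifs
  exacts [h, le_rfl]

theorem strictMonoOn_rpow_mul_massGrowth {α : ℝ} (hα : 0 < α) (b : ℝ) :
    StrictMonoOn (fun y => y ^ α * massGrowth b (Real.log (1 + y))) (Ioi 0) := by
  intro x hx y _ hxy
  have hx0 : (0 : ℝ) < x := hx
  have hlog : 0 < Real.log (1 + x) := Real.log_pos (by linarith)
  exact mul_lt_mul (Real.rpow_lt_rpow hx0.le hxy hα)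
    (monotone_massGrowth b (Real.log_le_log (by linarith) (by linarith))) (massGrowth_pos hlog)
    (Real.rpow_nonneg (hx0.trans hxy).le _)

theorem exists_rpow_mul_massGrowth_eq_one {α ε : ℝ} (hα : 0 < α) (b : ℝ) (hε : 0 < ε) :
    ∃ y : ℝ, 0 < y ∧ ε * y ^ α * massGrowth b (Real.log (1 + y)) = 1 := by
  have hcont : ContinuousOn (fun y => y ^ α * massGrowth b (Real.log (1 + y))) (Ici 0) := by
    have hlog : ContinuousOn (fun y : ℝ => Real.log (1 + y)) (Ici 0) :=
      ContinuousOn.log (by fun_prop) fun y (hy : 0 ≤ y) => by positivity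
    refine (continuousOn_id.rpow_const fun _ _ => Or.inr hα.le).mul ?_
    unfold massGrowth
    split_ifs
    exacts [hlog, continuousOn_const]
  have htop : Tendsto (fun y => y ^ α * massGrowth b (Real.log (1 + y))) atTop atTop := by
    unfold massGrowth
    split_ifs
    · exact (tendsto_rpow_atTop hα).atTop_mul_atTop₀
        (Real.tendsto_log_atTop.comp (tendsto_atTop_add_const_left _ _ tendsto_id))
    · simpa only [mul_one] using tendsto_rpow_atTop hα
  obtain ⟨y, hy, heq⟩ := isPreconnected_Ici.intermediate_value_Ici self_mem_Ici
    (le_principal_iff.2 (Ici_mem_atTop 0)) hcont htop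
    (show ε⁻¹ ∈ Ici _ by simpa [Real.zero_rpow hα.ne'] using hε.le)
  have hy0 : y ≠ 0 := by
    rintro rfl
    simp [Real.zero_rpow hα.ne', hε.ne] at heq
  exact ⟨y, lt_of_le_of_ne hy hy0.symm, by
    rw [mul_assoc, show y ^ α * _ = ε⁻¹ from heq, mul_inv_cancel₀ hε.ne']⟩

theorem isHeatScale_iff {n : ℕ} {μ₁ δ p ε y : ℝ} (hδ : 0 ≤ δ) :
    IsHeatScale n μ₁ δ p ε y ↔ 0 < y ∧ ε * y ^ (gammaF p (heatDim n μ₁ δ) / (p - 1)) *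
      massGrowth (Real.sqrt δ) (Real.log (1 + y)) = 1 := by
  rw [IsHeatScale, rpow_one_sub_sign hδ]

theorem exists_isHeatScale (n : ℕ) (μ₁ : ℝ) {δ p : ℝ} (hδ : 0 ≤ δ) (hp : 1 < p) :
    ∃ φ : ℝ → ℝ, 0 < gammaF p (heatDim n μ₁ δ) → ∀ ε, 0 < ε → IsHeatScale n μ₁ δ p ε (φ ε) := by
  by_cases hγ : 0 < gammaF p (heatDim n μ₁ δ)
  · choose! φ hφ using fun ε (hε : 0 < ε) =>
      exists_rpow_mul_massGrowth_eq_one (div_pos hγ (sub_pos.2 hp)) (Real.sqrt δ) hε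
    exact ⟨φ, fun _ ε hε => (isHeatScale_iff hδ).2 (hφ ε hε)⟩
  · exact ⟨0, fun h => absurd h hγ⟩

namespace IsHeatScale

variable {n : ℕ} {μ₁ δ p ε ε₁ ε₂ y y₁ y₂ : ℝ}

theorem anti (hδ : 0 ≤ δ) (hp : 1 < p) (hγ : 0 < gammaF p (heatDim n μ₁ δ))
    (h₁ : IsHeatScale n μ₁ δ p ε₁ y₁) (h₂ : IsHeatScale n μ₁ δ p ε₂ y₂) (hε₁ : 0 < ε₁)
    (hε : ε₁ ≤ ε₂) : y₂ ≤ y₁ := by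
  obtain ⟨hy₁, heq₁⟩ := (isHeatScale_iff hδ).1 h₁
  obtain ⟨hy₂, heq₂⟩ := (isHeatScale_iff hδ).1 h₂
  rw [mul_assoc] at heq₁ heq₂
  refine ((strictMonoOn_rpow_mul_massGrowth (div_pos hγ (sub_pos.2 hp)) (Real.sqrt δ)).le_iff_le
    hy₂ hy₁).1 ?_
  simpa only [eq_inv_of_mul_eq_one_right heq₁, eq_inv_of_mul_eq_one_right heq₂] using
    inv_anti₀ hε₁ hε

theorem unique (hδ : 0 ≤ δ) (hp : 1 < p) (hγ : 0 < gammaF p (heatDim n μ₁ δ)) (hε : 0 < ε)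
    (h₁ : IsHeatScale n μ₁ δ p ε y₁) (h₂ : IsHeatScale n μ₁ δ p ε y₂) : y₁ = y₂ :=
  (h₂.anti hδ hp hγ h₁ hε le_rfl).antisymm (h₁.anti hδ hp hγ h₂ hε le_rfl)

theorem eq_rpow (hp : 1 < p) (hδ : 0 < δ) (hγ : 0 < gammaF p (heatDim n μ₁ δ))
    (h : IsHeatScale n μ₁ δ p ε y) : y = ε ^ (-(p - 1) / gammaF p (heatDim n μ₁ δ)) := by
  have hp1 : 0 < p - 1 := sub_pos.2 hp
  obtain ⟨hy, heq⟩ := h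
  rw [Real.sign_of_pos hδ, sub_self, Real.rpow_zero, mul_one] at heq
  rw [eq_inv_of_mul_eq_one_left heq, ← Real.rpow_neg hy.le, ← Real.rpow_mul hy.le]
  field_simp
  rw [Real.rpow_one]

end IsHeatScale

theorem neg_div_gammaF_heatDim (n : ℕ) (μ₁ δ : ℝ) {p : ℝ} (hp : 1 < p) :
    -(p - 1) / gammaF p (heatDim n μ₁ δ)
      = -(2 / (p - 1) - n - (μ₁ - 1 - Real.sqrt δ) / 2)⁻¹ := by
  have hp1 : p - 1 ≠ 0 := (sub_pos.2 hp).ne'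
  have hγ : 2 / (p - 1) - n - (μ₁ - 1 - Real.sqrt δ) / 2
      = gammaF p (heatDim n μ₁ δ) / (p - 1) := by
    rw [gammaF, heatDim]
    field_simp
    ring
  rw [hγ, inv_div, neg_div]

/-! ### Lifespan estimates -/

theorem le_exp_one_mul_of_log_le {T Z : ℝ} (hT : 0 < T) (hZ : 0 < Z)
    (h : Real.log (1 + T) ≤ Real.log Z + 1) : T ≤ Real.exp 1 * Z := by
  have := Real.exp_le_exp.2 h
  rw [Real.exp_add, Real.exp_log (by linarith), Real.exp_log hZ] at this
  linarith

theorem exists_ge_and_le_rpow {s : ℝ} (hs : 0 < s) (K L : ℝ) : ∃ M : ℝ, L ≤ M ∧ K ≤ M ^ s :=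
  ((eventually_ge_atTop L).and ((tendsto_rpow_atTop hs).eventually_ge_atTop K)).exists

namespace LogSystem

variable {b p γ c H : ℝ}

theorem exists_le_mul_of_heat {y₁ : ℝ} (hp : 1 < p) (hb : 0 ≤ b) (hγ : 0 < γ) (hc : 0 < c)
    (hH : 0 < H) (hy₁ : 0 < y₁) :
    ∃ C : ℝ, 0 < C ∧ ∀ {ε T y : ℝ} {F D P : ℝ → ℝ}, 0 < ε → 0 < T → y₁ ≤ y →
      1 ≤ ε * y ^ (γ / (p - 1)) * massGrowth b (Real.log (1 + y)) →
      LogSystem b (ε * H) (Real.log (1 + T)) F D P →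
      (∀ τ ∈ Ioo 0 (Real.log (1 + T)), c * (Real.exp (γ * τ) * F τ ^ p) ≤ P τ) →
        T ≤ C * y := by
  obtain ⟨K, hheat⟩ := le_of_heat (γ := γ) hp hb hc
  obtain ⟨M, hLM, hKM⟩ := exists_ge_and_le_rpow (div_pos hγ (sub_pos.2 hp)) (K / H)
    (max (Real.exp 2 / y₁) (1 + 1 / y₁))
  rw [max_le_iff, div_le_iff₀ hy₁] at hLM
  have hM : 0 < M := lt_of_lt_of_le (by positivity) hLM.2
  refine ⟨Real.exp 1 * M, by positivity, fun {ε T y F D P} hε hT hy hscale h hP => ?_⟩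
  have hy0 : 0 < y := hy₁.trans_le hy
  have hMy : Real.exp 2 ≤ M * y := hLM.1.trans (by gcongr)
  have hMy' : 1 + y ≤ M * y :=
    calc 1 + y ≤ (1 + 1 / y₁) * y := by
          rw [add_mul, one_mul, add_comm, one_div_mul_eq_div]
          gcongr
          exact (one_le_div hy₁).2 hy
      _ ≤ M * y := by gcongr; exact hLM.2
  have hgrowth : massGrowth b (Real.log (1 + y)) ≤ massGrowth b (Real.log (M * y)) :=
    monotone_massGrowth b (Real.log_le_log (by positivity) hMy')
  rw [mul_assoc]
  refine le_exp_one_mul_of_log_le hT (by positivity) (hheat (mul_pos hε hH) h hP _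
    ((Real.le_log_iff_exp_le (by positivity)).2 hMy) ?_)
  rw [mul_comm (γ / (p - 1)), Real.exp_mul, Real.exp_log (by positivity),
    Real.mul_rpow hM.le hy0.le]
  calc K ≤ M ^ (γ / (p - 1)) * H := (div_le_iff₀ hH).1 hKM
    _ ≤ M ^ (γ / (p - 1)) * H *
          (ε * y ^ (γ / (p - 1)) * massGrowth b (Real.log (1 + y))) :=
        le_mul_of_one_le_right (by positivity) hscale
    _ ≤ M ^ (γ / (p - 1)) * H *
          (ε * y ^ (γ / (p - 1)) * massGrowth b (Real.log (M * y))) := by gcongr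
    _ = _ := by ring

theorem exists_le_rpow_of_wave {β c' τ₁ : ℝ} (hp : 1 < p) (hb : 0 ≤ b) (hc : 0 < c)
    (hc' : 0 < c') (hτ₁ : 0 ≤ τ₁) (hs : 0 < β + γ / (p - 1)) :
    ∃ C : ℝ, 0 < C ∧ ∀ {ε m T : ℝ} {F D P : ℝ → ℝ}, 0 < ε → ε ≤ 1 → 0 ≤ m → 0 < T →
      LogSystem b m (Real.log (1 + T)) F D P →
      (∀ τ ∈ Ioo 0 (Real.log (1 + T)), c * (Real.exp (γ * τ) * F τ ^ p) ≤ P τ) →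
      (∀ τ ∈ Ioo 0 (Real.log (1 + T)), τ₁ ≤ τ → c' * ε ^ p * Real.exp (β * τ) ≤ P τ) →
        T ≤ C * ε ^ (-(p / (β + γ / (p - 1)))) := by
  obtain ⟨K, hwave⟩ := le_of_wave (γ := γ) (β := β) hp hb hc hτ₁
  set s := β + γ / (p - 1)
  obtain ⟨M, hLM, hKM⟩ := exists_ge_and_le_rpow hs (K / c') (Real.exp (τ₁ + 3))
  have hM : 0 < M := (Real.exp_pos _).trans_le hLM
  refine ⟨Real.exp 1 * M, by positivity, fun {ε m T F D P} hε hε1 hm hT h hP hP' => ?_⟩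
  have hscale : 1 ≤ ε ^ (-(p / s)) := by
    refine Real.one_le_rpow_of_pos_of_le_one_of_nonpos hε hε1 (neg_nonpos.2 ?_)
    positivity
  have hpow : ε ^ p * (ε ^ (-(p / s))) ^ s = 1 := by
    rw [← Real.rpow_mul hε.le, neg_mul, div_mul_cancel₀ p hs.ne', ← Real.rpow_add hε,
      add_neg_cancel, Real.rpow_zero]
  rw [mul_assoc]
  refine le_exp_one_mul_of_log_le hT (by positivity) (hwave hm (by positivity) h hP hP' _
    ((Real.le_log_iff_exp_le (by positivity)).2 ?_) ?_)
  · exact hLM.trans (le_mul_of_one_le_right hM.le hscale)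
  · rw [mul_comm s, Real.exp_mul, Real.exp_log (by positivity),
      Real.mul_rpow hM.le (by positivity)]
    calc K ≤ M ^ s * c' * (ε ^ p * (ε ^ (-(p / s))) ^ s) := by
          rw [hpow, mul_one]
          exact (div_le_iff₀ hc').1 hKM
      _ = _ := by ring

end LogSystem

theorem lifespan_le {n : ℕ} {μ₁ μ₂ p R ε X : ℝ} {f g : Space n → ℝ}
    (h : ∀ T, 0 < T → ∀ u : ℝ → Lp ℝ 2 (volume : Measure (Space n)),
      IsEnergySolution n μ₁ μ₂ p ε f g T u → SupportedInCone R T u → T ≤ X) :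
    lifespan n μ₁ μ₂ p R f g ε ≤ ENNReal.ofReal X := by
  refine sSup_le ?_
  rintro _ ⟨T, hT, rfl, u, hu, hsupp⟩
  exact ENNReal.ofReal_le_ofReal (h T hT u hu hsupp)

theorem wave_add_heat_exponent (n : ℕ) (μ₁ δ : ℝ) {p : ℝ} (hp : 1 < p) :
    1 + n + (μ₁ - 1 - Real.sqrt δ) / 2 - (n + μ₁ - 1) * p / 2
      + gammaF p (heatDim n μ₁ δ) / (p - 1) = gammaS p (n + μ₁) / (2 * (p - 1)) := by
  have hp1 : p - 1 ≠ 0 := (sub_pos.2 hp).ne'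
  rw [gammaF, gammaS, heatDim]
  field_simp
  ring

section Lifespan

variable {n : ℕ} [NeZero n] {μ₁ μ₂ δ p R : ℝ} {f g : Space n → ℝ} (hδ : δ = discr μ₁ μ₂)
  (hδ0 : 0 ≤ δ) (hp : 1 < p) (hR : 1 ≤ R) (hf : MemLp f 2) (hg : MemLp g 2)
  (hf₀ : ∀ᵐ x, 0 ≤ f x) (h₀ : ∀ᵐ x, 0 ≤ (μ₁ - 1 + Real.sqrt δ) / 2 * f x + g x)
  (hpos : ¬ ∀ᵐ x, (μ₁ - 1 + Real.sqrt δ) / 2 * f x + g x = 0)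

include hδ hδ0 hp hR hf hg hf₀ h₀ hpos

theorem IsEnergySolution.exists_logSystem_sqrt :
    ∃ c c' H τ₁ : ℝ, 0 < c ∧ 0 < c' ∧ 0 < H ∧ 0 ≤ τ₁ ∧
      ∀ {ε T : ℝ} {u : ℝ → Lp ℝ 2 (volume : Measure (Space n))}, 0 < ε → 0 < T →
        IsEnergySolution n μ₁ μ₂ p ε f g T u → SupportedInCone R T u → ∃ F D P : ℝ → ℝ,
          LogSystem (Real.sqrt δ) (ε * H) (Real.log (1 + T)) F D P ∧
          (∀ τ ∈ Ioo 0 (Real.log (1 + T)),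
            c * (Real.exp (gammaF p (heatDim n μ₁ δ) * τ) * F τ ^ p) ≤ P τ) ∧
          (∀ τ ∈ Ioo 0 (Real.log (1 + T)), τ₁ ≤ τ → c' * ε ^ p * Real.exp ((1 + n
            + (μ₁ - 1 - Real.sqrt δ) / 2 - (n + μ₁ - 1) * p / 2) * τ) ≤ P τ) := by
  have hroots : (μ₁ - 1 + Real.sqrt δ) / 2 * ((μ₁ - 1 - Real.sqrt δ) / 2) = μ₂ := by
    have hsq := Real.sq_sqrt hδ0
    rw [discr] at hδ
    linear_combination (-hsq - hδ) / 4
  have hgap : (μ₁ - 1 + Real.sqrt δ) / 2 - (μ₁ - 1 - Real.sqrt δ) / 2 = Real.sqrt δ := by ring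
  have hle : (μ₁ - 1 - Real.sqrt δ) / 2 ≤ (μ₁ - 1 + Real.sqrt δ) / 2 := by
    linarith [Real.sqrt_nonneg δ]
  have hsys := IsEnergySolution.exists_logSystem (p := p) (by ring) hroots hle hp hR hf hg hf₀ h₀
    hpos
  rw [hgap] at hsys
  exact hsys

theorem exists_lifespan_le_mul_heatScale {φ : ℝ → ℝ} (hγ : 0 < gammaF p (heatDim n μ₁ δ))
    (hφ : ∀ ε, 0 < ε → IsHeatScale n μ₁ δ p ε (φ ε)) :
    ∃ C : ℝ, 0 < C ∧ ∀ ε, 0 < ε → ε ≤ 1 →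
      lifespan n μ₁ μ₂ p R f g ε ≤ ENNReal.ofReal (C * φ ε) := by
  obtain ⟨c, _, H, _, hc, -, hH, -, hsol⟩ :=
    IsEnergySolution.exists_logSystem_sqrt hδ hδ0 hp hR hf hg hf₀ h₀ hpos
  obtain ⟨C, hC, hle⟩ := LogSystem.exists_le_mul_of_heat hp (Real.sqrt_nonneg δ) hγ hc hH
    (hφ 1 one_pos).1
  refine ⟨C, hC, fun ε hε hε1 => lifespan_le fun T hT u hu hsupp => ?_⟩
  obtain ⟨F, D, P, hsys, hP, -⟩ := hsol hε hT hu hsupp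
  exact hle hε hT ((hφ ε hε).anti hδ0 hp hγ (hφ 1 one_pos) hε hε1)
    ((isHeatScale_iff hδ0).1 (hφ ε hε)).2.ge hsys hP

theorem exists_lifespan_le_mul_rpow (hγ : 0 < gammaS p (n + μ₁)) :
    ∃ C : ℝ, 0 < C ∧ ∀ ε, 0 < ε → ε ≤ 1 → lifespan n μ₁ μ₂ p R f g ε ≤
      ENNReal.ofReal (C * ε ^ (-(2 * p * (p - 1)) / gammaS p (n + μ₁))) := by
  obtain ⟨c, c', H, τ₁, hc, hc', hH, hτ₁, hsol⟩ :=
    IsEnergySolution.exists_logSystem_sqrt hδ hδ0 hp hR hf hg hf₀ h₀ hpos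
  have hp1 : 0 < p - 1 := sub_pos.2 hp
  have hs := wave_add_heat_exponent n μ₁ δ hp
  obtain ⟨C, hC, hle⟩ := LogSystem.exists_le_rpow_of_wave hp (Real.sqrt_nonneg δ) hc hc' hτ₁
    (hs.ge.trans_lt' (by positivity))
  have hexponent : -(2 * p * (p - 1)) / gammaS p (n + μ₁)
      = -(p / (gammaS p (n + μ₁) / (2 * (p - 1)))) := by
    field_simp
  rw [hs, ← hexponent] at hle
  refine ⟨C, hC, fun ε hε hε1 => lifespan_le fun T hT u hu hsupp => ?_⟩
  obtain ⟨F, D, P, hsys, hP, hP'⟩ := hsol hε hT hu hsupp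
  exact hle hε hε1 (by positivity) hT hsys hP hP'

theorem exists_lifespan_le {φ : ℝ → ℝ}
    (hφ : 0 < gammaF p (heatDim n μ₁ δ) → ∀ ε, 0 < ε → IsHeatScale n μ₁ δ p ε (φ ε)) :
    ∃ C : ℝ, 0 < C ∧ ∀ ε, 0 < ε → ε ≤ 1 →
      (0 < gammaF p (heatDim n μ₁ δ) →
        lifespan n μ₁ μ₂ p R f g ε ≤ ENNReal.ofReal (C * φ ε)) ∧
      (0 < gammaS p (n + μ₁) → lifespan n μ₁ μ₂ p R f g ε ≤
        ENNReal.ofReal (C * ε ^ (-(2 * p * (p - 1)) / gammaS p (n + μ₁)))) := by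
  have hheat (hγ : 0 < gammaF p (heatDim n μ₁ δ)) :=
    exists_lifespan_le_mul_heatScale hδ hδ0 hp hR hf hg hf₀ h₀ hpos hγ (hφ hγ)
  have hwave := exists_lifespan_le_mul_rpow hδ hδ0 hp hR hf hg hf₀ h₀ hpos
  choose! C₁ _ hle₁ using hheat
  choose! C₂ _ hle₂ using hwave
  refine ⟨max 1 (max C₁ C₂), lt_max_of_lt_left one_pos, fun ε hε hε1 => ⟨fun hγ => ?_,
    fun hγ => ?_⟩⟩
  · refine (hle₁ hγ ε hε hε1).trans (ENNReal.ofReal_le_ofReal ?_)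
    have := (hφ hγ ε hε).1
    gcongr
    simp
  · refine (hle₂ hγ ε hε hε1).trans (ENNReal.ofReal_le_ofReal ?_)
    gcongr
    simp

end Lifespan

end ScaleInvariantWave

theorem theorem1p2 (n : ℕ) (hn : 1 ≤ n) (μ₁ μ₂ δ : ℝ) (hδ : δ = discr μ₁ μ₂) (hδ0 : 0 ≤ δ)
    (p : ℝ) (hp1 : 1 < p) (hp : (p : EReal) < blowupExponent n μ₁ δ)
    (f g h : Space n → ℝ) (hf : MemH1 f) (hg : MemLp g 2)
    (hh : ∀ x, h x = (μ₁ - 1 + Real.sqrt δ) / 2 * f x + g x)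
    (hf0 : ∀ᵐ x, 0 ≤ f x) (hh0 : ∀ᵐ x, 0 ≤ h x) (hhpos : ¬ ∀ᵐ x, h x = 0)
    (R : ℝ) (hR : 1 ≤ R) :
    ∃ φ : ℝ → ℝ,
      -- in the heat-like regime `φ(ε)` is the unique positive solution of its equation
      ((((n : ℝ) - 2 < Real.sqrt δ ∧ Real.sqrt δ < n - dStar (n + μ₁) ∧ p ≤ 2 / (n - Real.sqrt δ))
          ∨ n - dStar (n + μ₁) ≤ Real.sqrt δ) →
        ∀ ε : ℝ, 0 < ε →
          IsHeatScale n μ₁ δ p ε (φ ε) ∧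
          (∀ y : ℝ, IsHeatScale n μ₁ δ p ε y → y = φ ε) ∧
          (0 < δ →
            φ ε = ε ^ (-(p - 1) / gammaF p (n + (μ₁ - 1 - Real.sqrt δ) / 2)) ∧
            φ ε = ε ^ (-(2 / (p - 1) - n - (μ₁ - 1 - Real.sqrt δ) / 2)⁻¹))) ∧
      -- the lifespan estimates
      ∃ ε₂ : ℝ, 0 < ε₂ ∧ ∃ C : ℝ, 0 < C ∧ ∀ ε : ℝ, 0 < ε → ε ≤ ε₂ →
        (Real.sqrt δ ≤ (n : ℝ) - 2 →
          lifespan n μ₁ μ₂ p R f g ε ≤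
            ENNReal.ofReal (C * ε ^ (-(2 * p * (p - 1)) / gammaS p (n + μ₁)))) ∧
        ((n : ℝ) - 2 < Real.sqrt δ → Real.sqrt δ < n - dStar (n + μ₁) →
          (p ≤ 2 / (n - Real.sqrt δ) →
            lifespan n μ₁ μ₂ p R f g ε ≤ ENNReal.ofReal (C * φ ε)) ∧
          (2 / (n - Real.sqrt δ) < p →
            lifespan n μ₁ μ₂ p R f g ε ≤
              ENNReal.ofReal (C * ε ^ (-(2 * p * (p - 1)) / gammaS p (n + μ₁))))) ∧
        (n - dStar (n + μ₁) ≤ Real.sqrt δ →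
          lifespan n μ₁ μ₂ p R f g ε ≤ ENNReal.ofReal (C * φ ε)) := by
  have : NeZero n := ⟨by omega⟩
  obtain rfl : h = fun x => (μ₁ - 1 + Real.sqrt δ) / 2 * f x + g x := funext hh
  obtain ⟨φ, hφ⟩ := exists_isHeatScale n μ₁ hδ0 hp1
  obtain ⟨C, hC, hlife⟩ := exists_lifespan_le hδ hδ0 hp1 hR hf.1 hg hf0 hh0 hhpos hφ
  refine ⟨φ, fun hregime ε hε => ?_, 1, one_pos, C, hC, fun ε hε hε1 => ?_⟩
  · have hγ : 0 < gammaF p (heatDim n μ₁ δ) := by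
      rcases hregime with ⟨-, hlt, hle⟩ | hle
      exacts [gammaF_pos_of_le_div hp1 hp hlt hle, gammaF_pos_of_sub_dStar_le hp1 hp hle]
    have hscale := hφ hγ ε hε
    refine ⟨hscale, fun y hy => hy.unique hδ0 hp1 hγ hε hscale, fun hδpos => ?_⟩
    have hrpow := hscale.eq_rpow hp1 hδpos hγ
    exact ⟨hrpow, hrpow.trans (by rw [neg_div_gammaF_heatDim n μ₁ δ hp1])⟩
  · obtain ⟨hheat, hwave⟩ := hlife ε hε hε1
    exact ⟨fun hle => hwave (gammaS_pos_of_le_sub_two hp1 hp hle),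
      fun _ hlt => ⟨fun hle => hheat (gammaF_pos_of_le_div hp1 hp hlt hle),
        fun hlt' => hwave (gammaS_pos_of_div_lt hp1 hp hlt hlt')⟩,
      fun hle => hheat (gammaF_pos_of_sub_dStar_le hp1 hp hle)⟩
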